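/- For $\theta>0$ let $C([-\theta,0],\mathbb R^n)$ carry the norm $\|X_0\|=\max_{\tau\in[-\theta,0]}|X_0(\tau)|$, where $|\cdot|$ is the Euclidean norm. Let $$A_0=\begin{pmatrix}-0.1&0.5\\-2&0\end{pmatrix},\qquad A_1=\begin{pmatrix}0&2\\-0.5&-0.1\end{pmatrix},$$ let $\varphi(s)=0$ for $s<0$, $\varphi(s)=s$ for $s\in[0,1]$, $\varphi(s)=1$ for $s>1$, and let $g(x,u)=(1+|x|^2)\big(\varphi(u)A_1+(1-\varphi(u))A_0\big)x$ for $x\in\mathbb R^2$, $u\in\mathbb R$. For $c>0$ consider the time-delay system, with state $X=(x,z_1,z_2)\in\mathbb R^2\times\mathbb R\times\mathbb R$, $$\begin{aligned}\dot x(t)&=c\,\varphi(z_2(t-2))\,g(x(t),z_1(t-1))+c\,\big(1-\varphi(z_2(t-2))\big)A_0x(t),\\ \dot z_1(t)&=-z_1(t),\\ \dot z_2(t)&=-z_2(t),\end{aligned}\tag{$*$}$$ and initial states $X_0\in C([-2,0],\mathbb R^4)$; let $X(\cdot;X_0)$ be the corresponding maximal solution. Given any $c>0$, the system $(*)$ 1.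 is forward complete: for every $X_0$ the solution $X(\cdot;X_0)$ exists (and is unique) for all positive times; 2. is locally exponentially stable: there are $\Delta,k,\mu>0$ such that $|X(t;X_0)|\le k\|X_0\|e^{-\mu t}$ for all $t\ge0$ whenever $\|X_0\|\le\Delta$; 3. is globally asymptotically stable: for every $\varepsilon>0$ there is $\delta>0$ such that $|X(t;X_0)|\le\varepsilon$ for all $t\ge0$ whenever $\|X_0\|\le\delta$; and $\lim_{t\to\infty}X(t;X_0)=0$ for every $X_0$. However, there exists $c>0$ such that the system $(*)$ 4. does not have bounded reachability sets (is not BRS), where BRS means that the system is forward complete and for all $\Delta,T>0$ there is $R>0$ such that $|X(t;X_0)|\le R$ for all $t\in[0,T]$ whenever $\|X_0\|\le\Delta$; 5. is not uniformly globally attractive (UGA), where UGA means that for all $\varepsilon,\Delta>0$ there is $T\ge0$ such that $|X(t;X_0)|\le\varepsilon$ for all $t\ge T$ whenever $\|X_0\|\le\Delta$; more precisely, for every $T>0$ there is an initial state $X_0$ with $\|X_0\|\le2$ and $|X(T;X_0)|\ge1$; 6. is not weakly uniformly globally attractive (WUGA), where WUGA means that for all $\varepsilon,\Delta>0$ there is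 $T\ge0$ such that, whenever $\|X_0\|\le\Delta$, $|X(t;X_0)|\le\varepsilon$ for some $t\in[0,T]$. -/

import Mathlib

open scoped Matrix

noncomputable section

namespace TimeDelay

/-- The state space `C([-θ, 0], ℝⁿ)`, with the supremum norm built on the Euclidean norm of `ℝⁿ`. -/
abbrev State (θ : ℝ) (n : ℕ) : Type := C(Set.Icc (-θ) (0 : ℝ), EuclideanSpace ℝ (Fin n))

section General

variable {θ : ℝ} {n : ℕ}

/-- `x` is a solution of `x'(t) = f(x_t)` on `[-θ, T)`, where `0 < T ≤ ∞`, with initial state `x₀`.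
In `deriv`, `ξ` is the history `x_t`, and the derivative is two-sided for `t > 0` and one-sided
at `t = 0`. The values of `x` outside `[-θ, T)` play no role. -/
structure IsSolution (f : State θ n → EuclideanSpace ℝ (Fin n)) (x₀ : State θ n) (T : EReal)
    (x : ℝ → EuclideanSpace ℝ (Fin n)) : Prop where
  pos : 0 < T
  continuousOn : ContinuousOn x {t : ℝ | -θ ≤ t ∧ (t : EReal) < T}
  initial : ∀ τ : Set.Icc (-θ) (0 : ℝ), x τ = x₀ τ
  deriv : ∀ t : ℝ, 0 ≤ t → (t : EReal) < T →
    ∃ ξ : State θ n, (∀ τ : Set.Icc (-θ) (0 : ℝ), ξ τ = x (t + τ)) ∧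
      HasDerivWithinAt x (f ξ) (Set.Ici 0) t

/-- `x`, on `[-θ, T)`, is the maximal solution with initial state `x₀`: it is a solution, and it
extends every solution with the same initial state. -/
def IsMaximalSolution (f : State θ n → EuclideanSpace ℝ (Fin n)) (x₀ : State θ n) (T : EReal)
    (x : ℝ → EuclideanSpace ℝ (Fin n)) : Prop :=
  IsSolution f x₀ T x ∧
    ∀ (S : EReal) (y : ℝ → EuclideanSpace ℝ (Fin n)), IsSolution f x₀ S y →
      S ≤ T ∧ ∀ t : ℝ, -θ ≤ t → (t : EReal) < S → y t = x t

/-- `x` is the maximal solution with initial state `x₀`, and it exists for all positive times. -/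
def IsGlobalSolution (f : State θ n → EuclideanSpace ℝ (Fin n)) (x₀ : State θ n)
    (x : ℝ → EuclideanSpace ℝ (Fin n)) : Prop :=
  IsMaximalSolution f x₀ ⊤ x

/-- Forward completeness (FC). -/
def ForwardComplete (f : State θ n → EuclideanSpace ℝ (Fin n)) : Prop :=
  ∀ x₀ : State θ n, ∃ x : ℝ → EuclideanSpace ℝ (Fin n), IsGlobalSolution f x₀ x

/-- Bounded reachability sets (BRS). -/
def BoundedReachabilitySets (f : State θ n → EuclideanSpace ℝ (Fin n)) : Prop :=
  ForwardComplete f ∧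
    ∀ Δ > 0, ∀ T > 0, ∃ R > 0, ∀ x₀ : State θ n, ‖x₀‖ ≤ Δ →
      ∀ x : ℝ → EuclideanSpace ℝ (Fin n), IsGlobalSolution f x₀ x →
        ∀ t ∈ Set.Icc (0 : ℝ) T, ‖x t‖ ≤ R

/-- Lyapunov stability of the origin. -/
def LyapunovStable (f : State θ n → EuclideanSpace ℝ (Fin n)) : Prop :=
  ∀ ε > 0, ∃ δ > 0, ∀ x₀ : State θ n, ‖x₀‖ ≤ δ →
    ∀ x : ℝ → EuclideanSpace ℝ (Fin n), IsGlobalSolution f x₀ x →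
      ∀ t : ℝ, 0 ≤ t → ‖x t‖ ≤ ε

/-- Global attractivity of the origin (GA). -/
def GloballyAttractive (f : State θ n → EuclideanSpace ℝ (Fin n)) : Prop :=
  ∀ (x₀ : State θ n) (x : ℝ → EuclideanSpace ℝ (Fin n)), IsGlobalSolution f x₀ x →
    Filter.Tendsto x Filter.atTop (nhds 0)

/-- Uniform global attractivity of the origin (UGA). -/
def UniformlyGloballyAttractive (f : State θ n → EuclideanSpace ℝ (Fin n)) : Prop :=
  ∀ ε > 0, ∀ Δ > 0, ∃ T : ℝ, 0 ≤ T ∧ ∀ x₀ : State θ n, ‖x₀‖ ≤ Δ →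
    ∀ x : ℝ → EuclideanSpace ℝ (Fin n), IsGlobalSolution f x₀ x →
      ∀ t : ℝ, T ≤ t → ‖x t‖ ≤ ε

/-- Weak uniform global attractivity of the origin (WUGA). -/
def WeaklyUniformlyGloballyAttractive (f : State θ n → EuclideanSpace ℝ (Fin n)) : Prop :=
  ∀ ε > 0, ∀ Δ > 0, ∃ T : ℝ, 0 ≤ T ∧ ∀ x₀ : State θ n, ‖x₀‖ ≤ Δ →
    ∀ x : ℝ → EuclideanSpace ℝ (Fin n), IsGlobalSolution f x₀ x →
      ∃ t ∈ Set.Icc (0 : ℝ) T, ‖x t‖ ≤ ε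

/-- Global asymptotic stability (GAS). -/
def GloballyAsymptoticallyStable (f : State θ n → EuclideanSpace ℝ (Fin n)) : Prop :=
  LyapunovStable f ∧ GloballyAttractive f

/-- Local exponential stability of the origin (LES). -/
def LocallyExponentiallyStable (f : State θ n → EuclideanSpace ℝ (Fin n)) : Prop :=
  ∃ Δ > 0, ∃ k > 0, ∃ μ > 0, ∀ x₀ : State θ n, ‖x₀‖ ≤ Δ →
    ∀ x : ℝ → EuclideanSpace ℝ (Fin n), IsGlobalSolution f x₀ x →
      ∀ t : ℝ, 0 ≤ t → ‖x t‖ ≤ k * ‖x₀‖ * Real.exp (-μ * t)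

end General

/-- The saturation function `φ : ℝ → [0, 1]`. -/
def sat (s : ℝ) : ℝ := if s < 0 then 0 else if s ≤ 1 then s else 1

/-- The matrix `A₀`. -/
def A₀ : Matrix (Fin 2) (Fin 2) ℝ := !![-0.1, 0.5; -2, 0]

/-- The matrix `A₁`. -/
def A₁ : Matrix (Fin 2) (Fin 2) ℝ := !![0, 2; -0.5, -0.1]

/-- `g(x, u) = (1 + |x|²) (φ(u) A₁ + (1 - φ(u)) A₀) x`, with the Euclidean norm of `x`. -/
def g (x : EuclideanSpace ℝ (Fin 2)) (u : ℝ) : EuclideanSpace ℝ (Fin 2) :=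
  (1 + ‖x‖ ^ 2) • WithLp.toLp 2 ((sat u • A₁ + (1 - sat u) • A₀) *ᵥ x.ofLp)

/-- The right-hand side, with state `X = (x, z₁, z₂)`, `x ∈ ℝ²` being the coordinates `0, 1` and
`z₁`, `z₂` the coordinates `2`, `3`:
`x'(t) = c φ(z₂(t - 2)) g(x(t), z₁(t - 1)) + c (1 - φ(z₂(t - 2))) A₀ x(t)`,
`z₁'(t) = -z₁(t)`, `z₂'(t) = -z₂(t)`. -/
def rhs (c : ℝ) (X : State 2 4) : EuclideanSpace ℝ (Fin 4) :=
  let now : EuclideanSpace ℝ (Fin 4) := X ⟨0, by norm_num⟩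
  let x : EuclideanSpace ℝ (Fin 2) := !₂[now 0, now 1]
  let z₁Delayed : ℝ := X ⟨-1, by norm_num⟩ 2
  let z₂Delayed : ℝ := X ⟨-2, by norm_num⟩ 3
  let v : EuclideanSpace ℝ (Fin 2) :=
    (c * sat z₂Delayed) • g x z₁Delayed +
      (c * (1 - sat z₂Delayed)) • WithLp.toLp 2 (A₀ *ᵥ x.ofLp)
  !₂[v 0, v 1, -now 2, -now 3]

end TimeDelay

end

noncomputable section

namespace TimeDelay

open Set Metric Filter Topology

/-! ### Parametrised ODEs: uniqueness, and planar existence up to exit from a ball. -/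

section ODE

variable {P E : Type*} [NormedAddCommGroup P] [NormedSpace ℝ P] [ProperSpace P]
  [NormedAddCommGroup E] [NormedSpace ℝ E] [ProperSpace E]

/-! The delayed inputs `w = φ(z₂(t-2))` and `u = φ(z₁(t-1))` are explicit functions of time, so the
system reduces to a planar ODE without delay, driven by a continuous input with values in [0,1]².

Positive claims. Every matrix A(u) = uA₁ + (1-u)A₀ has a quadratic Lyapunov function that still
decreases along A(u') for |u' - u| ≤ 1/400. While the input stays that close to a constant, the
superlinear term does not increase this function, so the solution grows at most exponentially
(`sqNorm_le_of_nearly_constant`). Uniform continuity of the input cuts [0,T] into finitely many such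
pieces, hence there is no finite escape (`exists_sqNorm_le`). The number of pieces depends on the
modulus of continuity of the history, not only on its norm, which leaves room for the failure of
uniformity. Once u ≤ 1/400 the decay is exponential (`sqNorm_le_of_small`). This holds eventually
for every solution and from the start for small histories, which gives attractivity and local
exponential stability.

Negative claims. Stability of each A(u) does not survive variation of u: with w = 1, the choice u =
`feedback x` makes the planar system escape before time 5/c
(`lt_of_isIntegralCurveOn_closedLoopField`). For t ≤ 1 the input u is read off the initial history,
so a history can replay the feedback along the escaping trajectory up to any prescribed radius. The
history of z₂ then turns w off, so quickly that |x|² at most halves. From there x' = cA₀x, and |x|²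
decays no faster than exp(-2ct), so a radius of order exp(2cT) keeps the solution outside the unit
ball up to time T. The history has norm at most 2 throughout (`exists_large_solution`), which
refutes BRS, UGA and WUGA at once. -/

lemma exists_lipschitzOnWith_section {G : P × E → E} (hG : ContDiff ℝ 1 G) (R : ℝ) :
    ∃ K, ∀ p, ‖p‖ ≤ R → LipschitzOnWith K (fun x => G (p, x)) (closedBall 0 R) := by
  obtain ⟨K, hK⟩ := (hG.locallyLipschitz.locallyLipschitzOn
    (s := closedBall (0 : P × E) R)).exists_lipschitzOnWith_of_compact (isCompact_closedBall _ _)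
  refine ⟨K, fun p hp x hx y hy => ?_⟩
  rw [mem_closedBall_zero_iff] at hx hy
  have := hK (x := (p, x)) (by simp [Prod.norm_def, hp, hx]) (y := (p, y))
    (by simp [Prod.norm_def, hp, hy])
  simpa [Prod.edist_eq] using this

/-- On a compact interval the input and both curves stay in one ball, where the field is Lipschitz
uniformly in time. -/
lemma eqOn_of_isIntegralCurveOn {G : P × E → E} (hG : ContDiff ℝ 1 G) {p : ℝ → P}
    (hp : Continuous p) {a b : ℝ} {x y : ℝ → E}
    (hx : IsIntegralCurveOn x (fun t z => G (p t, z)) (Icc a b))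
    (hy : IsIntegralCurveOn y (fun t z => G (p t, z)) (Icc a b)) (h : x a = y a) :
    EqOn x y (Icc a b) := by
  obtain ⟨R₁, hR₁⟩ := isCompact_Icc.exists_bound_of_continuousOn hp.continuousOn (s := Icc a b)
  obtain ⟨R₂, hR₂⟩ := isCompact_Icc.exists_bound_of_continuousOn hx.continuousOn
  obtain ⟨R₃, hR₃⟩ := isCompact_Icc.exists_bound_of_continuousOn hy.continuousOn
  obtain ⟨K, hK⟩ := exists_lipschitzOnWith_section hG (max R₁ (max R₂ R₃))
  have key : ∀ {z : ℝ → E}, IsIntegralCurveOn z (fun t z => G (p t, z)) (Icc a b) →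
      ∀ t ∈ Ico a b, HasDerivWithinAt z (G (p t, z t)) (Ici t) t := fun hz t ht =>
    (hz t (Ico_subset_Icc_self ht)).mono_of_mem_nhdsWithin (Icc_mem_nhdsGE_of_mem ht)
  refine ODE_solution_unique_of_mem_Icc_right (v := fun t z => G (p t, z))
    (s := fun _ => closedBall 0 (max R₁ (max R₂ R₃))) (K := K) (fun t ht => hK _ ?_)
    hx.continuousOn (key hx) (fun t ht => ?_) hy.continuousOn (key hy) (fun t ht => ?_) h
  · exact (hR₁ t (Ico_subset_Icc_self ht)).trans (by simp)
  · exact mem_closedBall_zero_iff.2 ((hR₂ t (Ico_subset_Icc_self ht)).trans (by simp))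
  · exact mem_closedBall_zero_iff.2 ((hR₃ t (Ico_subset_Icc_self ht)).trans (by simp))

/-- Coordinatewise truncation of the plane to the square `[-R, R]²`. -/
def clampSquare (R : ℝ) (x : ℝ × ℝ) : ℝ × ℝ := (max (-R) (min R x.1), max (-R) (min R x.2))

lemma lipschitzWith_clampSquare (R : ℝ) : LipschitzWith 1 (clampSquare R) := by
  have h1 : LipschitzWith 1 (fun x : ℝ × ℝ => max (-R) (min R x.1)) :=
    (LipschitzWith.prod_fst.const_min R).const_max (-R)
  have h2 : LipschitzWith 1 (fun x : ℝ × ℝ => max (-R) (min R x.2)) :=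
    (LipschitzWith.prod_snd.const_min R).const_max (-R)
  have h := h1.prodMk h2
  rw [max_self] at h
  exact h

lemma norm_clampSquare_le {R : ℝ} (hR : 0 ≤ R) (x : ℝ × ℝ) : ‖clampSquare R x‖ ≤ R := by
  simp only [clampSquare, Prod.norm_def, Real.norm_eq_abs]
  refine max_le (abs_le.2 ⟨le_max_left _ _, max_le (by linarith) (min_le_left _ _)⟩)
    (abs_le.2 ⟨le_max_left _ _, max_le (by linarith) (min_le_left _ _)⟩)

lemma clampSquare_of_norm_le {R : ℝ} {x : ℝ × ℝ} (hx : ‖x‖ ≤ R) : clampSquare R x = x := by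
  simp only [Prod.norm_def, Real.norm_eq_abs, max_le_iff, abs_le] at hx
  ext <;> simp [clampSquare, hx]

/-- Either the solution exists on `[0, T]`, or it reaches the boundary of the ball of radius `R`
at some earlier time. -/
lemma exists_isIntegralCurveOn_or_norm_eq {G : P × (ℝ × ℝ) → ℝ × ℝ} (hG : ContDiff ℝ 1 G)
    {p : ℝ → P} (hp : Continuous p) {T R : ℝ} (hT : 0 < T) {x₀ : ℝ × ℝ} (hx₀ : ‖x₀‖ < R) :
    ∃ τ ∈ Ioc 0 T, ∃ x : ℝ → ℝ × ℝ, x 0 = x₀ ∧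
      IsIntegralCurveOn x (fun t z => G (p t, z)) (Icc 0 τ) ∧
      (‖x τ‖ = R ∨ τ = T) := by
  have hR : 0 ≤ R := (norm_nonneg _).trans hx₀.le
  obtain ⟨R₁, hR₁⟩ := isCompact_Icc.exists_bound_of_continuousOn hp.continuousOn (s := Icc 0 T)
  obtain ⟨K, hK⟩ := exists_lipschitzOnWith_section hG (max R₁ R)
  obtain ⟨M, hM⟩ := (isCompact_closedBall (0 : P × (ℝ × ℝ)) (max R₁ R)).exists_bound_of_continuousOn
    hG.continuous.continuousOn
  set L : NNReal := ⟨max M 0, le_max_right _ _⟩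
  -- Clamping bounds the speed by `L`, so the Picard radius `L * T` covers all of [0, T] in one go.
  -- Until the first exit from the ball (a square, in the sup norm) the clamp is inactive.
  set f : ℝ → ℝ × ℝ → ℝ × ℝ := fun t z => G (p t, clampSquare R z)
  have hf : IsPicardLindelof f (tmin := 0) (tmax := T) ⟨0, le_rfl, hT.le⟩ x₀
      (L * ⟨T, hT.le⟩) 0 L K := by
    refine ⟨fun t ht => ?_, fun z _ => ?_, fun t ht z _ => ?_, ?_⟩
    · have := (hK (p t) ((hR₁ t ht).trans (le_max_left _ _))).comp
        ((lipschitzWith_clampSquare R).lipschitzOnWith (s := closedBall x₀ (L * ⟨T, hT.le⟩ : NNReal)))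
        (fun z _ => mem_closedBall_zero_iff.2
          ((norm_clampSquare_le hR z).trans (le_max_right _ _)))
      rw [mul_one] at this
      exact this
    · exact (hG.continuous.comp (hp.prodMk continuous_const)).continuousOn
    · refine (hM _ ?_).trans (le_max_left M 0)
      rw [mem_closedBall_zero_iff, Prod.norm_def]
      exact max_le_max (hR₁ t ht) (norm_clampSquare_le hR z)
    · simp only [sub_zero, sub_self, hT.le, sup_of_le_left, NNReal.coe_zero]
      rfl
  obtain ⟨x, hx0, hx⟩ := hf.exists_eq_forall_mem_Icc_hasDerivWithinAt₀
  have hxc : ContinuousOn x (Icc 0 T) := fun t ht => (hx t ht).continuousWithinAt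
  have restrict : ∀ τ ∈ Ioc 0 T, (∀ t ∈ Icc 0 τ, ‖x t‖ ≤ R) →
      IsIntegralCurveOn x (fun t z => G (p t, z)) (Icc 0 τ) := by
    intro τ hτ hb t ht
    have := (hx t ⟨ht.1, ht.2.trans hτ.2⟩).mono (Icc_subset_Icc_right hτ.2)
    simpa [f, clampSquare_of_norm_le (hb t ht)] using this
  by_cases hb : ∀ t ∈ Icc 0 T, ‖x t‖ ≤ R
  · exact ⟨T, ⟨hT, le_rfl⟩, x, hx0, restrict T ⟨hT, le_rfl⟩ hb, Or.inr rfl⟩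
  · push Not at hb
    obtain ⟨t₁, ht₁, hlt⟩ := hb
    set S : Set ℝ := {t ∈ Icc 0 T | R ≤ ‖x t‖}
    have hSc : IsClosed S := hxc.norm.preimage_isClosed_of_isClosed isClosed_Icc isClosed_Ici
    have hSne : S.Nonempty := ⟨t₁, ht₁, hlt.le⟩
    have hSb : BddBelow S := ⟨0, fun t ht => ht.1.1⟩
    set τ := sInf S
    have hτS : τ ∈ S := hSc.csInf_mem hSne hSb
    have hτ0 : 0 < τ := by
      refine lt_of_le_of_ne hτS.1.1 fun h => ?_
      have := hτS.2
      rw [← h, hx0] at this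
      linarith
    have hbelow : ∀ t ∈ Ico 0 τ, ‖x t‖ < R := fun t ht => by
      by_contra! h
      exact absurd (csInf_le hSb ⟨⟨ht.1, ht.2.le.trans hτS.1.2⟩, h⟩) (not_le.2 ht.2)
    have hτR : ‖x τ‖ = R := by
      refine le_antisymm ?_ hτS.2
      have hcl : τ ∈ closure (Ico 0 τ) := by
        rw [closure_Ico hτ0.ne]; exact ⟨hτ0.le, le_rfl⟩
      have hc : ContinuousWithinAt (fun t => ‖x t‖) (Ico 0 τ) τ :=
        (hxc.norm τ hτS.1).mono fun t ht => ⟨ht.1, ht.2.le.trans hτS.1.2⟩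
      exact closure_minimal (t := Iic R) (image_subset_iff.2 fun t ht => (hbelow t ht).le) isClosed_Iic
        (hc.mem_closure_image hcl)
    refine ⟨τ, ⟨hτ0, hτS.1.2⟩, x, hx0, restrict τ ⟨hτ0, hτS.1.2⟩ fun t ht => ?_, Or.inl hτR⟩
    rcases ht.2.eq_or_lt with h | h
    · rw [h, hτR]
    · exact (hbelow t ⟨ht.1, h⟩).le

end ODE

/-! ### Scalar Grönwall inequalities. -/

section Gronwall

/-- Scalar linear Grönwall inequality, with a rate of either sign. -/
lemma le_mul_exp_of_deriv_le {V V' : ℝ → ℝ} {a b C : ℝ}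
    (hV : ∀ t ∈ Icc a b, HasDerivWithinAt V (V' t) (Icc a b) t)
    (h : ∀ t ∈ Icc a b, V' t ≤ C * V t) {t : ℝ} (ht : t ∈ Icc a b) :
    V t ≤ V a * Real.exp (C * (t - a)) := by
  have hexp : ∀ s, HasDerivAt (fun s => Real.exp (-C * (s - a)))
      (Real.exp (-C * (s - a)) * (-C)) s := fun s => by
    simpa using (((hasDerivAt_id s).sub_const a).const_mul (-C)).exp
  have hanti : AntitoneOn (fun s => V s * Real.exp (-C * (s - a))) (Icc a b) := by
    refine antitoneOn_of_hasDerivWithinAt_nonpos (convex_Icc a b)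
      (fun s hs => ((hV s hs).mul (hexp s).hasDerivWithinAt).continuousWithinAt)
      (fun s hs => ((hV s (interior_subset hs)).mul (hexp s).hasDerivWithinAt).mono
        interior_subset) fun s hs => ?_
    have := h s (interior_subset hs)
    have he := Real.exp_pos (-C * (s - a))
    nlinarith
  have := hanti ⟨le_rfl, ht.1.trans ht.2⟩ ht ht.1
  simp only [sub_self, mul_zero, Real.exp_zero, mul_one] at this
  calc V t = V t * Real.exp (-C * (t - a)) * Real.exp (C * (t - a)) := by
        rw [mul_assoc, ← Real.exp_add]; simp
    _ ≤ _ := by gcongr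

lemma mul_exp_le_of_le_deriv {V V' : ℝ → ℝ} {a b C : ℝ}
    (hV : ∀ t ∈ Icc a b, HasDerivWithinAt V (V' t) (Icc a b) t)
    (h : ∀ t ∈ Icc a b, C * V t ≤ V' t) {t : ℝ} (ht : t ∈ Icc a b) :
    V a * Real.exp (C * (t - a)) ≤ V t := by
  have := le_mul_exp_of_deriv_le (V := fun s => -V s) (V' := fun s => -V' s) (C := C)
    (fun s hs => (hV s hs).neg) (fun s hs => by have := h s hs; linarith) ht
  linarith

end Gronwall

/-! ### The planar subsystem: Lyapunov estimates and global existence. -/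

/-- The square of the Euclidean norm on the plane `ℝ × ℝ`. -/
def sqNorm (x : ℝ × ℝ) : ℝ := x.1 ^ 2 + x.2 ^ 2

/-- The linear vector field `x ↦ (u A₁ + (1 - u) A₀) x`. -/
def mixedField (u : ℝ) (x : ℝ × ℝ) : ℝ × ℝ :=
  (-(1 - u) / 10 * x.1 + (1 / 2 + 3 / 2 * u) * x.2, -(2 - 3 / 2 * u) * x.1 - u / 10 * x.2)

/-- The vector field of the `x`-subsystem, with the delayed quantities `(w, u)` as inputs. -/
def planarField (c : ℝ) (q : (ℝ × ℝ) × (ℝ × ℝ)) : ℝ × ℝ :=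
  (c * q.1.1 * (1 + sqNorm q.2)) • mixedField q.1.2 q.2 + (c * (1 - q.1.1)) • mixedField 0 q.2

lemma contDiff_planarField (c : ℝ) : ContDiff ℝ 1 (planarField c) := by
  unfold planarField mixedField sqNorm
  fun_prop

lemma sqNorm_nonneg (x : ℝ × ℝ) : 0 ≤ sqNorm x := by unfold sqNorm; positivity

lemma norm_sq_le_sqNorm (x : ℝ × ℝ) : ‖x‖ ^ 2 ≤ sqNorm x := by
  rw [Prod.norm_def, sqNorm]
  rcases max_cases ‖x.1‖ ‖x.2‖ with ⟨h, -⟩ | ⟨h, -⟩ <;> rw [h, Real.norm_eq_abs, sq_abs] <;>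
    nlinarith [sq_nonneg x.1, sq_nonneg x.2]

/-- The symmetric bilinear form of a common Lyapunov function of the matrices
`u A₁ + (1 - u) A₀` with `u` near `u₀`. -/
def lyapunovBilin (u₀ : ℝ) (x y : ℝ × ℝ) : ℝ :=
  (2 - 3 / 2 * u₀) * x.1 * y.1 + (u₀ - 1 / 2) / 10 * (x.1 * y.2 + x.2 * y.1) +
    (1 / 2 + 3 / 2 * u₀) * x.2 * y.2

lemma hasDerivWithinAt_fst {x : ℝ → ℝ × ℝ} {v : ℝ × ℝ} {s : Set ℝ} {t : ℝ}
    (h : HasDerivWithinAt x v s t) : HasDerivWithinAt (fun t => (x t).1) v.1 s t :=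
  (ContinuousLinearMap.fst ℝ ℝ ℝ).hasFDerivAt.comp_hasDerivWithinAt t h

lemma hasDerivWithinAt_snd {x : ℝ → ℝ × ℝ} {v : ℝ × ℝ} {s : Set ℝ} {t : ℝ}
    (h : HasDerivWithinAt x v s t) : HasDerivWithinAt (fun t => (x t).2) v.2 s t :=
  (ContinuousLinearMap.snd ℝ ℝ ℝ).hasFDerivAt.comp_hasDerivWithinAt t h

lemma hasDerivWithinAt_lyapunovBilin (u₀ : ℝ) {x : ℝ → ℝ × ℝ} {v : ℝ × ℝ} {s : Set ℝ} {t : ℝ}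
    (h : HasDerivWithinAt x v s t) :
    HasDerivWithinAt (fun t => lyapunovBilin u₀ (x t) (x t)) (2 * lyapunovBilin u₀ (x t) v) s t := by
  have h1 := hasDerivWithinAt_fst h
  have h2 := hasDerivWithinAt_snd h
  unfold lyapunovBilin
  refine ((((h1.const_mul (2 - 3 / 2 * u₀)).mul h1).add
    (((h1.mul h2).add (h2.mul h1)).const_mul ((u₀ - 1 / 2) / 10))).add
    ((h2.const_mul (1 / 2 + 3 / 2 * u₀)).mul h2)).congr_deriv ?_
  ring

lemma hasDerivWithinAt_sqNorm {x : ℝ → ℝ × ℝ} {v : ℝ × ℝ} {s : Set ℝ} {t : ℝ}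
    (h : HasDerivWithinAt x v s t) :
    HasDerivWithinAt (fun t => sqNorm (x t)) (2 * ((x t).1 * v.1 + (x t).2 * v.2)) s t := by
  have h1 := hasDerivWithinAt_fst h
  have h2 := hasDerivWithinAt_snd h
  unfold sqNorm
  refine ((h1.pow 2).add (h2.pow 2)).congr_deriv ?_
  simp
  ring

lemma lyapunovBilin_planarField (c u₀ : ℝ) (p x : ℝ × ℝ) :
    lyapunovBilin u₀ x (planarField c (p, x)) =
      c * (p.1 * (1 + sqNorm x) * lyapunovBilin u₀ x (mixedField p.2 x) +
        (1 - p.1) * lyapunovBilin u₀ x (mixedField 0 x)) := by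
  simp only [lyapunovBilin, planarField, Prod.fst_add, Prod.snd_add, Prod.smul_fst, Prod.smul_snd,
    smul_eq_mul]
  ring

lemma sqNorm_le_lyapunovBilin {u₀ : ℝ} (h : u₀ ∈ Icc (0 : ℝ) 1) (x : ℝ × ℝ) :
    9 / 20 * sqNorm x ≤ lyapunovBilin u₀ x x := by
  unfold sqNorm lyapunovBilin
  obtain ⟨h0, h1⟩ := h
  nlinarith [mul_nonneg h0 (sq_nonneg (x.1 + x.2)), mul_nonneg (sub_nonneg.2 h1) (sq_nonneg (x.1 - x.2)),
    mul_nonneg (sub_nonneg.2 h1) (sq_nonneg (x.1 + x.2)), mul_nonneg h0 (sq_nonneg (x.1 - x.2)),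
    mul_nonneg h0 (sq_nonneg x.2), mul_nonneg (sub_nonneg.2 h1) (sq_nonneg x.1),
    mul_nonneg h0 (sq_nonneg x.1), mul_nonneg (sub_nonneg.2 h1) (sq_nonneg x.2)]

lemma lyapunovBilin_le_sqNorm {u₀ : ℝ} (h : u₀ ∈ Icc (0 : ℝ) 1) (x : ℝ × ℝ) :
    lyapunovBilin u₀ x x ≤ 41 / 20 * sqNorm x := by
  unfold sqNorm lyapunovBilin
  obtain ⟨h0, h1⟩ := h
  nlinarith [mul_nonneg h0 (sq_nonneg (x.1 + x.2)), mul_nonneg (sub_nonneg.2 h1) (sq_nonneg (x.1 - x.2)),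
    mul_nonneg (sub_nonneg.2 h1) (sq_nonneg (x.1 + x.2)), mul_nonneg h0 (sq_nonneg (x.1 - x.2)),
    mul_nonneg h0 (sq_nonneg x.2), mul_nonneg (sub_nonneg.2 h1) (sq_nonneg x.1),
    mul_nonneg h0 (sq_nonneg x.1), mul_nonneg (sub_nonneg.2 h1) (sq_nonneg x.2)]

/-- The diagonal part of the form is conserved by the off-diagonal part of the matrix, but its
damping vanishes in one direction at u = 0 and u = 1. The cross term of the form redistributes the
damping evenly, 1/20 on each axis, and leaves only a small mixed term. -/
lemma lyapunovBilin_mixedField_self (u : ℝ) (x : ℝ × ℝ) :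
    lyapunovBilin u x (mixedField u x) =
      -(1 / 20) * ((2 - 3 / 2 * u) * x.1 ^ 2 + (1 / 2 + 3 / 2 * u) * x.2 ^ 2)
        - (u - 1 / 2) / 100 * (x.1 * x.2) := by
  unfold lyapunovBilin mixedField
  ring

lemma lyapunovBilin_mixedField_sub (u₀ u : ℝ) (x : ℝ × ℝ) :
    lyapunovBilin u₀ x (mixedField u x) = lyapunovBilin u₀ x (mixedField u₀ x) +
      (u - u₀) * lyapunovBilin u₀ x (1 / 10 * x.1 + 3 / 2 * x.2, 3 / 2 * x.1 - 1 / 10 * x.2) := by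
  unfold lyapunovBilin mixedField
  ring

lemma abs_lyapunovBilin_le {u₀ : ℝ} (h : u₀ ∈ Icc (0 : ℝ) 1) (x : ℝ × ℝ) :
    |lyapunovBilin u₀ x (1 / 10 * x.1 + 3 / 2 * x.2, 3 / 2 * x.1 - 1 / 10 * x.2)| ≤
      4 * sqNorm x := by
  obtain ⟨h0, h1⟩ := h
  have e : lyapunovBilin u₀ x (1 / 10 * x.1 + 3 / 2 * x.2, 3 / 2 * x.1 - 1 / 10 * x.2) =
      (1 / 8 ) * (x.1 ^ 2 - x.2 ^ 2) + 15 / 4 * (x.1 * x.2) := by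
    unfold lyapunovBilin
    ring
  rw [e, abs_le]
  unfold sqNorm
  constructor <;> nlinarith [sq_nonneg (x.1 + x.2), sq_nonneg (x.1 - x.2)]

/-- At `u₀` itself the rate is at most -(1/40 - 1/400), since the diagonal coefficients are at least
1/2. Moving `u` by 1/400 costs at most 4/400, because the field is affine in `u`. -/
lemma lyapunovBilin_mixedField_le {u₀ u : ℝ} (h : u₀ ∈ Icc (0 : ℝ) 1) (hu : |u - u₀| ≤ 1 / 400)
    (x : ℝ × ℝ) : lyapunovBilin u₀ x (mixedField u x) ≤ -(1 / 100) * sqNorm x := by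
  rw [lyapunovBilin_mixedField_sub, lyapunovBilin_mixedField_self]
  have h1 := mul_le_mul hu (abs_lyapunovBilin_le h x) (abs_nonneg _) (by norm_num)
  rw [← abs_mul] at h1
  have h2 := (le_abs_self _).trans h1
  obtain ⟨h0, h1⟩ := h
  unfold sqNorm at *
  nlinarith [mul_nonneg h0 (sq_nonneg (x.1 + x.2)), mul_nonneg (sub_nonneg.2 h1) (sq_nonneg (x.1 - x.2)),
    mul_nonneg h0 (sq_nonneg x.2), mul_nonneg (sub_nonneg.2 h1) (sq_nonneg x.1),
    mul_nonneg h0 (sq_nonneg x.1), mul_nonneg (sub_nonneg.2 h1) (sq_nonneg x.2)]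

lemma lyapunovBilin_mixedField_zero_le {u₀ : ℝ} (h : u₀ ∈ Icc (0 : ℝ) 1) (x : ℝ × ℝ) :
    lyapunovBilin u₀ x (mixedField 0 x) ≤ 4 * sqNorm x := by
  rw [lyapunovBilin_mixedField_sub]
  have h1 := lyapunovBilin_mixedField_le h (u := u₀) (by simp) x
  have h2 := abs_le.1 (abs_lyapunovBilin_le h x)
  have h3 := sqNorm_nonneg x
  obtain ⟨h0, h4⟩ := h
  nlinarith [mul_le_mul_of_nonneg_left h2.1 h0]

/-- On an interval on which `u` is nearly constant, the solution grows at most exponentially. -/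
lemma sqNorm_le_of_nearly_constant {c : ℝ} (hc : 0 < c) {p : ℝ → ℝ × ℝ}
    (hp : ∀ t, (p t).1 ∈ Icc (0 : ℝ) 1) {u₀ : ℝ} (hu₀ : u₀ ∈ Icc (0 : ℝ) 1) {a b : ℝ}
    (hu : ∀ t ∈ Icc a b, |(p t).2 - u₀| ≤ 1 / 400) {x : ℝ → ℝ × ℝ}
    (hx : IsIntegralCurveOn x (fun t z => planarField c (p t, z)) (Icc a b)) {t : ℝ}
    (ht : t ∈ Icc a b) : sqNorm (x t) ≤ 5 * Real.exp (20 * c * (t - a)) * sqNorm (x a) := by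
  have h := le_mul_exp_of_deriv_le (C := 20 * c)
    (fun s hs => hasDerivWithinAt_lyapunovBilin u₀ (hx s hs)) (fun s hs => ?_) ht
  · have h1 := sqNorm_le_lyapunovBilin hu₀ (x t)
    have h2 := mul_le_mul_of_nonneg_right (lyapunovBilin_le_sqNorm hu₀ (x a))
      (Real.exp_pos (20 * c * (t - a))).le
    have h3 := mul_nonneg (sqNorm_nonneg (x a)) (Real.exp_pos (20 * c * (t - a))).le
    nlinarith
  · rw [lyapunovBilin_planarField]
    have h1 := lyapunovBilin_mixedField_le hu₀ (hu s hs) (x s)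
    have h2 := lyapunovBilin_mixedField_zero_le hu₀ (x s)
    have h3 := sqNorm_le_lyapunovBilin hu₀ (x s)
    have h4 := sqNorm_nonneg (x s)
    obtain ⟨hw0, hw1⟩ := hp s
    -- The cubic part has the good sign; only the linear `A₀` part can increase the form.
    have h5 : (p s).1 * (1 + sqNorm (x s)) * lyapunovBilin u₀ (x s) (mixedField (p s).2 (x s)) ≤ 0 :=
      mul_nonpos_of_nonneg_of_nonpos (by positivity) (by linarith)
    have h6 : (1 - (p s).1) * lyapunovBilin u₀ (x s) (mixedField 0 (x s)) ≤ 4 * sqNorm (x s) := by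
      nlinarith [mul_le_mul_of_nonneg_left h2 (sub_nonneg.2 hw1), mul_nonneg hw0 h4]
    have h7 := mul_le_mul_of_nonneg_left (add_le_add h5 h6) hc.le
    nlinarith [mul_le_mul_of_nonneg_left h3 hc.le]

/-- While `u` is close to zero, the solution decays exponentially. -/
lemma sqNorm_le_of_small {c : ℝ} (hc : 0 < c) {p : ℝ → ℝ × ℝ}
    (hp : ∀ t, (p t).1 ∈ Icc (0 : ℝ) 1) {a b : ℝ}
    (hu : ∀ t ∈ Icc a b, |(p t).2| ≤ 1 / 400) {x : ℝ → ℝ × ℝ}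
    (hx : IsIntegralCurveOn x (fun t z => planarField c (p t, z)) (Icc a b)) {t : ℝ}
    (ht : t ∈ Icc a b) : sqNorm (x t) ≤ 5 * Real.exp (-(c / 200) * (t - a)) * sqNorm (x a) := by
  have hu₀ : (0 : ℝ) ∈ Icc (0 : ℝ) 1 := by simp
  have h := le_mul_exp_of_deriv_le (C := -(c / 200))
    (fun s hs => hasDerivWithinAt_lyapunovBilin 0 (hx s hs)) (fun s hs => ?_) ht
  · have h1 := sqNorm_le_lyapunovBilin hu₀ (x t)
    have h2 := mul_le_mul_of_nonneg_right (lyapunovBilin_le_sqNorm hu₀ (x a))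
      (Real.exp_pos (-(c / 200) * (t - a))).le
    have h3 := mul_nonneg (sqNorm_nonneg (x a)) (Real.exp_pos (-(c / 200) * (t - a))).le
    nlinarith
  · rw [lyapunovBilin_planarField]
    have h1 := lyapunovBilin_mixedField_le hu₀ (by simpa using hu s hs) (x s)
    have h2 := lyapunovBilin_mixedField_le hu₀ (u := 0) (by simp) (x s)
    have h3 := lyapunovBilin_le_sqNorm hu₀ (x s)
    have h4 := sqNorm_nonneg (x s)
    obtain ⟨hw0, hw1⟩ := hp s
    have h5 := mul_le_mul_of_nonneg_left h1 (mul_nonneg hw0 (by positivity : 0 ≤ 1 + sqNorm (x s)))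
    have h6 := mul_le_mul_of_nonneg_left h2 (sub_nonneg.2 hw1)
    have h7 : 0 ≤ (p s).1 * (sqNorm (x s) * sqNorm (x s)) := by positivity
    have h8 : (p s).1 * (1 + sqNorm (x s)) * lyapunovBilin 0 (x s) (mixedField (p s).2 (x s)) +
        (1 - (p s).1) * lyapunovBilin 0 (x s) (mixedField 0 (x s)) ≤ -(1 / 100) * sqNorm (x s) := by
      nlinarith
    have h9 := mul_le_mul_of_nonneg_left h8 hc.le
    nlinarith [mul_le_mul_of_nonneg_left h3 hc.le, mul_nonneg hc.le h4]

/-- A priori bound, uniform in the interval of existence within `[0, T]`. -/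
lemma exists_sqNorm_le {c : ℝ} (hc : 0 < c) {p : ℝ → ℝ × ℝ} (hpc : Continuous p)
    (hp : ∀ t, p t ∈ Icc (0 : ℝ) 1 ×ˢ Icc (0 : ℝ) 1) (T : ℝ) (x₀ : ℝ × ℝ) :
    ∃ M, ∀ τ ≤ T, ∀ x : ℝ → ℝ × ℝ, x 0 = x₀ →
      IsIntegralCurveOn x (fun t z => planarField c (p t, z)) (Icc 0 τ) →
      ∀ t ∈ Icc 0 τ, sqNorm (x t) ≤ M := by
  have huc : UniformContinuousOn (fun t => (p t).2) (Icc 0 T) :=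
    isCompact_Icc.uniformContinuousOn_of_continuous (continuous_snd.comp hpc).continuousOn
  obtain ⟨δ, hδ, hδu⟩ := Metric.uniformContinuousOn_iff_le.1 huc (1 / 400) (by norm_num)
  -- `N` pieces of length `δ` cover [0, T], and each costs at most a factor `B`.
  obtain ⟨N, hN⟩ := exists_nat_ge (T / δ)
  rw [div_le_iff₀ hδ] at hN
  set B := 5 * Real.exp (20 * c * δ)
  have hB : 1 ≤ B := by
    have : 1 ≤ Real.exp (20 * c * δ) := Real.one_le_exp (by positivity)
    simp only [B]; linarith
  refine ⟨B ^ N * sqNorm x₀, fun τ hτ x hx0 hx t ht => ?_⟩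
  have key : ∀ n : ℕ, ∀ t ∈ Icc 0 τ, t ≤ n * δ → sqNorm (x t) ≤ B ^ n * sqNorm x₀ := by
    intro n
    induction n with
    | zero =>
      intro t ht htn
      have : t = 0 := le_antisymm (by simpa using htn) ht.1
      simp [this, hx0]
    | succ n ih =>
      intro t ht htn
      have hn0 : 0 ≤ (n : ℝ) * δ := by positivity
      by_cases h : t ≤ n * δ
      · exact (ih t ht h).trans
          (mul_le_mul_of_nonneg_right (pow_le_pow_right₀ hB n.le_succ) (sqNorm_nonneg _))
      · push Not at h
        push_cast at htn
        have hmem : (n : ℝ) * δ ∈ Icc 0 τ := ⟨hn0, h.le.trans ht.2⟩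
        have h1 := ih _ hmem le_rfl
        have h2 := sqNorm_le_of_nearly_constant hc (fun s => (hp s).1) (hp (n * δ)).2
          (a := n * δ) (b := t) (fun s hs => by
            simpa [Real.dist_eq] using hδu s ⟨hn0.trans hs.1, (hs.2.trans ht.2).trans hτ⟩ _
              ⟨hn0, hmem.2.trans hτ⟩ (by
                rw [Real.dist_eq, abs_of_nonneg (by linarith [hs.1])]; linarith [hs.2]))
          (hx.mono (Icc_subset_Icc hn0 ht.2)) ⟨h.le, le_rfl⟩
        calc sqNorm (x t) ≤ 5 * Real.exp (20 * c * (t - n * δ)) * sqNorm (x (n * δ)) := h2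
          _ ≤ B * (B ^ n * sqNorm x₀) := by
            refine mul_le_mul ?_ h1 (sqNorm_nonneg _) (by positivity)
            simp only [B]
            gcongr
            linarith
          _ = _ := by ring
  exact key N t ht ((ht.2.trans hτ).trans hN)

/-- The `x`-subsystem has no finite escape time. -/
lemma exists_global_isIntegralCurveOn {c : ℝ} (hc : 0 < c) {p : ℝ → ℝ × ℝ} (hpc : Continuous p)
    (hp : ∀ t, p t ∈ Icc (0 : ℝ) 1 ×ˢ Icc (0 : ℝ) 1) (x₀ : ℝ × ℝ) :
    ∃ x : ℝ → ℝ × ℝ, x 0 = x₀ ∧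
      IsIntegralCurveOn x (fun t z => planarField c (p t, z)) (Ici 0) := by
  have hex : ∀ n : ℕ, ∃ x : ℝ → ℝ × ℝ, x 0 = x₀ ∧
      IsIntegralCurveOn x (fun t z => planarField c (p t, z)) (Icc 0 (n + 1)) := by
    intro n
    obtain ⟨M, hM⟩ := exists_sqNorm_le hc hpc hp (n + 1) x₀
    obtain ⟨τ, hτ, x, hx0, hx, h | h⟩ := exists_isIntegralCurveOn_or_norm_eq
      (contDiff_planarField c) hpc (T := n + 1) (by positivity) (R := ‖x₀‖ + |M| + 1) (x₀ := x₀)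
      (by have := abs_nonneg M; linarith)
    · have h1 := hM τ hτ.2 x hx0 hx τ ⟨hτ.1.le, le_rfl⟩
      have h2 := norm_sq_le_sqNorm (x τ)
      rw [h] at h2
      nlinarith [le_abs_self M, abs_nonneg M, norm_nonneg x₀]
    · exact ⟨x, hx0, h ▸ hx⟩
  choose X hX0 hX using hex
  have hEq : ∀ n m : ℕ, ∀ t : ℝ, 0 ≤ t → t ≤ n + 1 → t ≤ m + 1 → X n t = X m t :=
    fun n m t h0 hn hm => eqOn_of_isIntegralCurveOn (contDiff_planarField c) hpc
      ((hX n).mono (Icc_subset_Icc_right hn)) ((hX m).mono (Icc_subset_Icc_right hm))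
      ((hX0 n).trans (hX0 m).symm) ⟨h0, le_rfl⟩
  have hfl : ∀ (n : ℕ) (t : ℝ), 0 ≤ t → t ≤ n + 1 → X ⌊t⌋₊ t = X n t := fun n t h0 hn =>
    hEq _ _ t h0 (Nat.lt_floor_add_one t).le hn
  -- The nth solution lives up to n + 1, so the one selected at t is defined slightly beyond t.
  refine ⟨fun t => X ⌊t⌋₊ t, by simp [hX0], fun t ht => ?_⟩
  have ht0 : 0 ≤ t := ht
  have hlt : t < (⌊t⌋₊ : ℝ) + 1 := Nat.lt_floor_add_one t
  have hnhds : Icc 0 ((⌊t⌋₊ : ℝ) + 1) ∈ 𝓝[Ici 0] t := by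
    rw [← Ici_inter_Iic]
    exact inter_mem self_mem_nhdsWithin (mem_nhdsWithin_of_mem_nhds (Iic_mem_nhds hlt))
  have h1 := (hX ⌊t⌋₊ t ⟨ht0, hlt.le⟩).mono_of_mem_nhdsWithin hnhds
  refine h1.congr_of_eventuallyEq ?_ rfl
  filter_upwards [hnhds] with s hs using hfl _ s hs.1 hs.2

/-! ### Saturation, histories and the explicit delayed inputs. -/

lemma sat_eq (s : ℝ) : sat s = max 0 (min 1 s) := by
  unfold sat
  split_ifs with h1 h2
  · rw [max_eq_left]; exact (min_le_right _ _).trans h1.le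
  · push Not at h1
    rw [min_eq_right h2, max_eq_right h1]
  · push Not at h2
    rw [min_eq_left h2.le, max_eq_right zero_le_one]

lemma continuous_sat : Continuous sat := by
  simp only [funext sat_eq]
  fun_prop

lemma sat_mem_Icc (s : ℝ) : sat s ∈ Icc (0 : ℝ) 1 := by
  rw [sat_eq]
  exact ⟨le_max_left _ _, max_le zero_le_one (min_le_left _ _)⟩

lemma sat_le_abs (s : ℝ) : sat s ≤ |s| := by
  rw [sat_eq]
  exact max_le (abs_nonneg _) ((min_le_right _ _).trans (le_abs_self _))

lemma sat_of_mem_Icc {s : ℝ} (hs : s ∈ Icc (0 : ℝ) 1) : sat s = s := by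
  rw [sat_eq, min_eq_right hs.2, max_eq_right hs.1]

/-- The history, extended to `ℝ` by constants. -/
def pastPath (X₀ : State 2 4) (t : ℝ) : EuclideanSpace ℝ (Fin 4) :=
  X₀ (projIcc (-2) 0 (by norm_num) t)

lemma continuous_pastPath (X₀ : State 2 4) : Continuous (pastPath X₀) :=
  X₀.continuous.comp continuous_projIcc

lemma pastPath_coe (X₀ : State 2 4) (τ : Icc (-2 : ℝ) 0) : pastPath X₀ τ = X₀ τ := by
  simp [pastPath]

lemma pastPath_of_nonneg (X₀ : State 2 4) {t : ℝ} (ht : 0 ≤ t) :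
    pastPath X₀ t = pastPath X₀ 0 := by
  unfold pastPath
  rw [projIcc_of_right_le _ ht, projIcc_right]

lemma norm_pastPath_le (X₀ : State 2 4) (t : ℝ) : ‖pastPath X₀ t‖ ≤ ‖X₀‖ :=
  X₀.norm_coe_le_norm _

/-- A coordinate `i` that satisfies `z' = -z` for positive times. -/
def decayPath (X₀ : State 2 4) (i : Fin 4) (t : ℝ) : ℝ :=
  pastPath X₀ t i * Real.exp (-max t 0)

lemma continuous_coord (i : Fin 4) : Continuous fun x : EuclideanSpace ℝ (Fin 4) => x i := by
  fun_prop

lemma continuous_decayPath (X₀ : State 2 4) (i : Fin 4) : Continuous (decayPath X₀ i) :=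
  ((continuous_coord i).comp (continuous_pastPath X₀)).mul
    (Real.continuous_exp.comp (continuous_id.max continuous_const).neg)

lemma decayPath_of_nonpos (X₀ : State 2 4) (i : Fin 4) {t : ℝ} (ht : t ≤ 0) :
    decayPath X₀ i t = pastPath X₀ t i := by
  simp [decayPath, ht]

lemma decayPath_of_nonneg (X₀ : State 2 4) (i : Fin 4) {t : ℝ} (ht : 0 ≤ t) :
    decayPath X₀ i t = pastPath X₀ 0 i * Real.exp (-t) := by
  simp [decayPath, ht, pastPath_of_nonneg X₀ ht]

lemma abs_decayPath_le (X₀ : State 2 4) (i : Fin 4) (t : ℝ) : |decayPath X₀ i t| ≤ ‖X₀‖ := by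
  rw [decayPath, abs_mul, abs_of_pos (Real.exp_pos _)]
  have h1 : |pastPath X₀ t i| ≤ ‖X₀‖ := by
    rw [← Real.norm_eq_abs]
    exact (PiLp.norm_apply_le _ i).trans (norm_pastPath_le X₀ t)
  have h2 : Real.exp (-max t 0) ≤ 1 := Real.exp_le_one_iff.2 (by simp)
  nlinarith [abs_nonneg (pastPath X₀ t i)]

lemma tendsto_decayPath (X₀ : State 2 4) (i : Fin 4) :
    Tendsto (decayPath X₀ i) atTop (𝓝 0) := by
  have h := (Real.tendsto_exp_neg_atTop_nhds_zero).const_mul (pastPath X₀ 0 i)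
  rw [mul_zero] at h
  refine h.congr' ?_
  filter_upwards [eventually_ge_atTop 0] with t ht using (decayPath_of_nonneg X₀ i ht).symm

lemma hasDerivWithinAt_decayPath (X₀ : State 2 4) (i : Fin 4) {t : ℝ} (ht : 0 ≤ t) :
    HasDerivWithinAt (decayPath X₀ i) (-decayPath X₀ i t) (Ici 0) t := by
  have h := (((hasDerivAt_id t).neg.exp).const_mul (pastPath X₀ 0 i)).hasDerivWithinAt (s := Ici 0)
  refine (h.congr (fun s hs => decayPath_of_nonneg X₀ i hs)
    (decayPath_of_nonneg X₀ i ht)).congr_deriv ?_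
  rw [decayPath_of_nonneg X₀ i ht]
  simp

/-- The inputs `(φ(z₂(t - 2)), φ(z₁(t - 1)))` of the `x`-subsystem. -/
def delayedInput (X₀ : State 2 4) (t : ℝ) : ℝ × ℝ :=
  (sat (decayPath X₀ 3 (t - 2)), sat (decayPath X₀ 2 (t - 1)))

lemma continuous_delayedInput (X₀ : State 2 4) : Continuous (delayedInput X₀) :=
  (continuous_sat.comp ((continuous_decayPath X₀ 3).comp (continuous_sub_right 2))).prodMk
    (continuous_sat.comp ((continuous_decayPath X₀ 2).comp (continuous_sub_right 1)))

lemma delayedInput_mem (X₀ : State 2 4) (t : ℝ) :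
    delayedInput X₀ t ∈ Icc (0 : ℝ) 1 ×ˢ Icc (0 : ℝ) 1 := ⟨sat_mem_Icc _, sat_mem_Icc _⟩

lemma hasDerivWithinAt_iff_coord {X : ℝ → EuclideanSpace ℝ (Fin 4)}
    {v : EuclideanSpace ℝ (Fin 4)} {s : Set ℝ} {t : ℝ} :
    HasDerivWithinAt X v s t ↔ ∀ i, HasDerivWithinAt (fun t => X t i) (v i) s t := by
  rw [hasDerivWithinAt_iff_hasFDerivWithinAt, hasFDerivWithinAt_euclidean]
  refine forall_congr' fun i => ?_
  rw [hasDerivWithinAt_iff_hasFDerivWithinAt]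
  have : PiLp.proj 2 (fun _ : Fin 4 => ℝ) i ∘L ContinuousLinearMap.toSpanSingleton ℝ v =
      ContinuousLinearMap.toSpanSingleton ℝ (v i) := by
    ext; simp
  rw [← this]

lemma rhs_eq (c : ℝ) (ξ : State 2 4) :
    rhs c ξ =
      !₂[(planarField c ((sat (ξ ⟨-2, by norm_num⟩ 3), sat (ξ ⟨-1, by norm_num⟩ 2)),
            (ξ ⟨0, by norm_num⟩ 0, ξ ⟨0, by norm_num⟩ 1))).1,
          (planarField c ((sat (ξ ⟨-2, by norm_num⟩ 3), sat (ξ ⟨-1, by norm_num⟩ 2)),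
            (ξ ⟨0, by norm_num⟩ 0, ξ ⟨0, by norm_num⟩ 1))).2,
          -ξ ⟨0, by norm_num⟩ 2, -ξ ⟨0, by norm_num⟩ 3] := by
  simp only [rhs, planarField, mixedField, g, A₀, A₁, sqNorm, EuclideanSpace.real_norm_sq_eq,
    Fin.sum_univ_two]
  ext i
  fin_cases i <;> simp <;> ring

lemma norm_sq_eq (x : EuclideanSpace ℝ (Fin 4)) :
    ‖x‖ ^ 2 = sqNorm (x 0, x 1) + x 2 ^ 2 + x 3 ^ 2 := by
  rw [EuclideanSpace.real_norm_sq_eq, Fin.sum_univ_four, sqNorm]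

/-! ### Reduction of the delay system to the planar one; the positive claims. -/

section Solutions

variable {c : ℝ} {X₀ : State 2 4} {X : ℝ → EuclideanSpace ℝ (Fin 4)}

lemma IsSolution.eq_pastPath {S : EReal} (h : IsSolution (rhs c) X₀ S X) {t : ℝ}
    (ht : t ∈ Icc (-2 : ℝ) 0) : X t = pastPath X₀ t := by
  have := h.initial ⟨t, ht⟩
  rw [← pastPath_coe] at this
  exact this

lemma IsSolution.coord_eq_decayPath {S : EReal} (h : IsSolution (rhs c) X₀ S X) {i : Fin 4}
    (hi : ∀ ξ : State 2 4, rhs c ξ i = -ξ ⟨0, by norm_num⟩ i) {t : ℝ} (ht : -2 ≤ t)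
    (htS : (t : EReal) < S) : X t i = decayPath X₀ i t := by
  rcases le_total t 0 with h0 | h0
  · rw [decayPath_of_nonpos X₀ i h0, h.eq_pastPath ⟨ht, h0⟩]
  have hd : ∀ s ∈ Icc 0 t, HasDerivWithinAt (fun s => X s i) (-X s i) (Icc 0 t) s := by
    intro s hs
    obtain ⟨ξ, hξ, hd⟩ := h.deriv s hs.1 ((EReal.coe_le_coe_iff.2 hs.2).trans_lt htS)
    have h1 := (hasDerivWithinAt_iff_coord.1 hd i).mono (fun s hs => hs.1 : Icc 0 t ⊆ Ici 0)
    have h2 := hξ ⟨0, by norm_num⟩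
    rw [hi, h2] at h1
    simpa using h1
  have hle := le_mul_exp_of_deriv_le (C := -1) hd (fun s _ => by simp) ⟨h0, le_rfl⟩
  -- Grönwall from both sides, with equality in the hypothesis, pins down the exponential.
  have hge := mul_exp_le_of_le_deriv (C := -1) hd (fun s _ => by simp) ⟨h0, le_rfl⟩
  rw [decayPath_of_nonneg X₀ i h0, ← h.eq_pastPath ⟨by norm_num, le_rfl⟩]
  simpa using le_antisymm hle hge

lemma rhs_two (c : ℝ) (ξ : State 2 4) : rhs c ξ 2 = -ξ ⟨0, by norm_num⟩ 2 := by
  rw [rhs_eq]; rfl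

lemma rhs_three (c : ℝ) (ξ : State 2 4) : rhs c ξ 3 = -ξ ⟨0, by norm_num⟩ 3 := by
  rw [rhs_eq]; rfl

lemma IsSolution.isIntegralCurveOn {S : EReal} (h : IsSolution (rhs c) X₀ S X) {b : ℝ}
    (hb : (b : EReal) < S) :
    IsIntegralCurveOn (fun t => (X t 0, X t 1))
      (fun t z => planarField c (delayedInput X₀ t, z)) (Icc 0 b) := by
  intro t ht
  have htS : (t : EReal) < S := (EReal.coe_le_coe_iff.2 ht.2).trans_lt hb
  obtain ⟨ξ, hξ, hd⟩ := h.deriv t ht.1 htS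
  have hd := hasDerivWithinAt_iff_coord.1 (hd.mono (fun s hs => hs.1 : Icc 0 b ⊆ Ici 0))
  have h0 := hξ ⟨0, by norm_num⟩
  have h1 := hξ ⟨-1, by norm_num⟩
  have h2 := hξ ⟨-2, by norm_num⟩
  simp only [add_zero] at h0
  have hlt : ∀ s : ℝ, s ≤ 0 → ((t + s : ℝ) : EReal) < S := fun s hs =>
    (EReal.coe_le_coe_iff.2 (by linarith)).trans_lt htS
  have e : delayedInput X₀ t = (sat (ξ ⟨-2, by norm_num⟩ 3), sat (ξ ⟨-1, by norm_num⟩ 2)) := by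
    rw [h1, h2, h.coord_eq_decayPath (rhs_two c) (by linarith [ht.1]) (hlt _ (by norm_num)),
      h.coord_eq_decayPath (rhs_three c) (by linarith [ht.1]) (hlt _ (by norm_num))]
    rfl
  have := (hd 0).prodMk (hd 1)
  rw [rhs_eq] at this
  refine this.congr_deriv ?_
  simp [e, h0]

/-- The solution built from a solution `x` of the planar subsystem. -/
def assemble (X₀ : State 2 4) (x : ℝ → ℝ × ℝ) (t : ℝ) : EuclideanSpace ℝ (Fin 4) :=
  -- For t ≥ 0 the history terms cancel; for t ≤ 0 the last term is x(0), which cancels the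
  -- subtracted constant when x starts at the present value.
  !₂[pastPath X₀ t 0 - pastPath X₀ 0 0 + (x (max t 0)).1,
    pastPath X₀ t 1 - pastPath X₀ 0 1 + (x (max t 0)).2, decayPath X₀ 2 t, decayPath X₀ 3 t]

lemma continuous_assemble {x : ℝ → ℝ × ℝ} (hx : ContinuousOn x (Ici 0)) :
    Continuous (assemble X₀ x) := by
  have hxc : Continuous fun t => x (max t 0) :=
    hx.comp_continuous (by fun_prop) fun t => mem_Ici.2 (le_max_right _ _)
  have hp (i) : Continuous fun t => pastPath X₀ t i :=
    (continuous_coord i).comp (continuous_pastPath X₀)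
  refine (PiLp.continuous_toLp 2 _).comp (continuous_pi fun i => ?_)
  fin_cases i
  · exact ((hp 0).sub continuous_const).add (continuous_fst.comp hxc)
  · exact ((hp 1).sub continuous_const).add (continuous_snd.comp hxc)
  · exact continuous_decayPath X₀ 2
  · exact continuous_decayPath X₀ 3

lemma isSolution_assemble {x : ℝ → ℝ × ℝ} (hx0 : x 0 = (pastPath X₀ 0 0, pastPath X₀ 0 1))
    (hx : IsIntegralCurveOn x (fun t z => planarField c (delayedInput X₀ t, z)) (Ici 0)) :
    IsSolution (rhs c) X₀ ⊤ (assemble X₀ x) := by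
  have hcont : Continuous (assemble X₀ x) := continuous_assemble hx.continuousOn
  refine ⟨EReal.coe_lt_top 0, hcont.continuousOn, fun τ => ?_, fun t ht _ => ?_⟩
  · have hτ : max (τ : ℝ) 0 = 0 := max_eq_right τ.2.2
    rw [← pastPath_coe]
    ext i
    fin_cases i <;> simp [assemble, hτ, hx0, decayPath_of_nonpos X₀ _ τ.2.2]
  · refine ⟨⟨fun τ => assemble X₀ x (t + τ), by fun_prop⟩, fun τ => rfl, ?_⟩
    rw [rhs_eq, hasDerivWithinAt_iff_coord]
    have hplanar : ∀ s, 0 ≤ s → assemble X₀ x s 0 = (x s).1 ∧ assemble X₀ x s 1 = (x s).2 := by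
      intro s hs
      simp [assemble, pastPath_of_nonneg X₀ hs, hs]
    have e : planarField c ((sat (assemble X₀ x (t + -2) 3), sat (assemble X₀ x (t + -1) 2)),
        (assemble X₀ x (t + 0) 0, assemble X₀ x (t + 0) 1)) =
        planarField c (delayedInput X₀ t, x t) := by
      rw [add_zero, (hplanar t ht).1, (hplanar t ht).2]
      rfl
    have hxt := hx t ht
    intro i
    fin_cases i
    · refine ((hasDerivWithinAt_fst hxt).congr (fun s hs => (hplanar s hs).1)
        (hplanar t ht).1).congr_deriv ?_
      exact congrArg Prod.fst e.symm
    · refine ((hasDerivWithinAt_snd hxt).congr (fun s hs => (hplanar s hs).2)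
        (hplanar t ht).2).congr_deriv ?_
      exact congrArg Prod.snd e.symm
    · simpa [assemble] using hasDerivWithinAt_decayPath X₀ 2 ht
    · simpa [assemble] using hasDerivWithinAt_decayPath X₀ 3 ht

lemma IsSolution.eq_of_isSolution {S S' : EReal} {Y : ℝ → EuclideanSpace ℝ (Fin 4)}
    (hX : IsSolution (rhs c) X₀ S X) (hY : IsSolution (rhs c) X₀ S' Y) {t : ℝ} (ht : -2 ≤ t)
    (htS : (t : EReal) < S) (htS' : (t : EReal) < S') : X t = Y t := by
  rcases le_total t 0 with h0 | h0
  · rw [hX.eq_pastPath ⟨ht, h0⟩, hY.eq_pastPath ⟨ht, h0⟩]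
  have hz : (0 : ℝ) ∈ Icc (-2 : ℝ) 0 := by norm_num
  have hxy := eqOn_of_isIntegralCurveOn (contDiff_planarField c) (continuous_delayedInput X₀)
    (hX.isIntegralCurveOn htS) (hY.isIntegralCurveOn htS')
    (by simp [hX.eq_pastPath hz, hY.eq_pastPath hz]) ⟨h0, le_rfl⟩
  simp only [Prod.mk.injEq] at hxy
  ext i
  fin_cases i
  · exact hxy.1
  · exact hxy.2
  · exact (hX.coord_eq_decayPath (rhs_two c) ht htS).trans
      (hY.coord_eq_decayPath (rhs_two c) ht htS').symm
  · exact (hX.coord_eq_decayPath (rhs_three c) ht htS).trans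
      (hY.coord_eq_decayPath (rhs_three c) ht htS').symm

theorem forwardComplete_rhs (hc : 0 < c) : ForwardComplete (rhs c) := by
  intro X₀
  obtain ⟨x, hx0, hx⟩ := exists_global_isIntegralCurveOn hc (continuous_delayedInput X₀)
    (delayedInput_mem X₀) (pastPath X₀ 0 0, pastPath X₀ 0 1)
  have h := isSolution_assemble hx0 hx
  exact ⟨_, h, fun S Y hY => ⟨le_top, fun t ht htS =>
    hY.eq_of_isSolution h ht htS (EReal.coe_lt_top t)⟩⟩

lemma IsGlobalSolution.norm_sq (h : IsGlobalSolution (rhs c) X₀ X) {t : ℝ} (ht : 0 ≤ t) :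
    ‖X t‖ ^ 2 = sqNorm (X t 0, X t 1) + decayPath X₀ 2 t ^ 2 + decayPath X₀ 3 t ^ 2 := by
  rw [norm_sq_eq, h.1.coord_eq_decayPath (rhs_two c) (by linarith) (EReal.coe_lt_top t),
    h.1.coord_eq_decayPath (rhs_three c) (by linarith) (EReal.coe_lt_top t)]

theorem locallyExponentiallyStable_rhs (hc : 0 < c) : LocallyExponentiallyStable (rhs c) := by
  -- The gain 3 exceeds √5, with 5 from `sqNorm_le_of_small`; the rate c/200 there is for the
  -- squared norm, hence c/400, and the z-coordinates decay at rate 1.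
  refine ⟨1 / 400, by norm_num, 3, by norm_num, min (c / 400) 1, by positivity,
    fun X₀ hX₀ X hX t ht => ?_⟩
  set μ := min (c / 400) 1
  have h1 := sqNorm_le_of_small hc (fun s => (delayedInput_mem X₀ s).1) (a := 0) (b := t)
    (fun s _ => by
      rw [abs_of_nonneg (delayedInput_mem X₀ s).2.1]
      exact (sat_le_abs _).trans ((abs_decayPath_le X₀ 2 _).trans hX₀))
    (hX.1.isIntegralCurveOn (EReal.coe_lt_top t)) ⟨ht, le_rfl⟩
  have h0 : ‖X 0‖ ≤ ‖X₀‖ := by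
    rw [hX.1.eq_pastPath ⟨by norm_num, le_rfl⟩]; exact norm_pastPath_le X₀ 0
  have h2 := hX.norm_sq le_rfl
  have h3 := hX.norm_sq ht
  rw [decayPath_of_nonneg X₀ 2 ht, decayPath_of_nonneg X₀ 3 ht, mul_pow, mul_pow] at h3
  rw [decayPath_of_nonneg X₀ 2 le_rfl, decayPath_of_nonneg X₀ 3 le_rfl] at h2
  simp only [neg_zero, Real.exp_zero, mul_one] at h2
  have e1 : Real.exp (-(c / 200) * (t - 0)) ≤ Real.exp (-μ * t) ^ 2 := by
    rw [← Real.exp_nat_mul, Real.exp_le_exp]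
    push_cast
    nlinarith [mul_le_mul_of_nonneg_right (min_le_left (c / 400) 1) ht]
  have e2 : Real.exp (-t) ^ 2 ≤ Real.exp (-μ * t) ^ 2 := by
    refine pow_le_pow_left₀ (Real.exp_pos _).le (Real.exp_le_exp.2 ?_) 2
    nlinarith [mul_le_mul_of_nonneg_right (min_le_right (c / 400) 1) ht]
  have h5 : ‖X 0‖ ^ 2 ≤ ‖X₀‖ ^ 2 := pow_le_pow_left₀ (norm_nonneg _) h0 2
  refine (sq_le_sq₀ (norm_nonneg _) (by positivity)).1 ?_
  set F := Real.exp (-μ * t) ^ 2 with hF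
  have hF0 : 0 ≤ F := sq_nonneg _
  have k1 := mul_le_mul_of_nonneg_right e1 (sqNorm_nonneg (X 0 0, X 0 1))
  have k2 := mul_le_mul_of_nonneg_left e2 (sq_nonneg (pastPath X₀ 0 2))
  have k3 := mul_le_mul_of_nonneg_left e2 (sq_nonneg (pastPath X₀ 0 3))
  have k4 := mul_le_mul_of_nonneg_right h5 hF0
  rw [mul_pow, mul_pow, ← hF]
  nlinarith [mul_nonneg hF0 (sq_nonneg (pastPath X₀ 0 2)),
    mul_nonneg hF0 (sq_nonneg (pastPath X₀ 0 3)), mul_nonneg hF0 (sq_nonneg ‖X₀‖)]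

lemma LocallyExponentiallyStable.lyapunovStable {θ : ℝ} {n : ℕ}
    {f : State θ n → EuclideanSpace ℝ (Fin n)} (h : LocallyExponentiallyStable f) :
    LyapunovStable f := by
  obtain ⟨Δ, hΔ, k, hk, μ, hμ, H⟩ := h
  intro ε hε
  refine ⟨min Δ (ε / k), by positivity, fun x₀ hx₀ x hx t ht => ?_⟩
  have h1 := H x₀ (hx₀.trans (min_le_left _ _)) x hx t ht
  have h2 : ‖x₀‖ ≤ ε / k := hx₀.trans (min_le_right _ _)
  rw [le_div_iff₀ hk] at h2
  have h3 : Real.exp (-μ * t) ≤ 1 := Real.exp_le_one_iff.2 (by nlinarith)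
  have h4 : 0 ≤ k * ‖x₀‖ := by positivity
  nlinarith

theorem globallyAttractive_rhs (hc : 0 < c) : GloballyAttractive (rhs c) := by
  intro X₀ X hX
  have hz := tendsto_decayPath X₀ 2
  have hev : ∀ᶠ t in atTop, |decayPath X₀ 2 t| ≤ 1 / 400 :=
    hz.abs.eventually_le_const (by norm_num)
  obtain ⟨a', ha'⟩ := eventually_atTop.1 hev
  -- The shift by 1 is the delay of z₁.
  set a := max 0 (a' + 1)
  have hx : Tendsto (fun t => sqNorm (X t 0, X t 1)) atTop (𝓝 0) := by
    have hexp : Tendsto (fun t => 5 * Real.exp (-(c / 200) * (t - a)) * sqNorm (X a 0, X a 1))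
        atTop (𝓝 0) := by
      have : Tendsto (fun t : ℝ => -(c / 200) * (t - a)) atTop atBot :=
        (tendsto_atTop_add_const_right atTop (-a) tendsto_id).const_mul_atTop_of_neg (by linarith)
      simpa using ((Real.tendsto_exp_atBot.comp this).const_mul 5).mul_const
        (sqNorm (X a 0, X a 1))
    refine squeeze_zero' (Eventually.of_forall fun t => sqNorm_nonneg _) ?_ hexp
    filter_upwards [eventually_ge_atTop a] with t hat
    refine sqNorm_le_of_small hc (fun s => (delayedInput_mem X₀ s).1) (fun s hs => ?_)
      ((hX.1.isIntegralCurveOn (EReal.coe_lt_top t)).mono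
        (Icc_subset_Icc_left (le_max_left _ _))) ⟨hat, le_rfl⟩
    rw [abs_of_nonneg (delayedInput_mem X₀ s).2.1]
    exact (sat_le_abs _).trans (ha' _ (by linarith [hs.1, le_max_right 0 (a' + 1)]))
  have hsum := (hx.add (hz.pow 2)).add ((tendsto_decayPath X₀ 3).pow 2)
  have hsq : Tendsto (fun t => ‖X t‖ ^ 2) atTop (𝓝 0) := by
    refine Tendsto.congr' ?_ (by simpa using hsum)
    filter_upwards [eventually_ge_atTop 0] with t ht using (hX.norm_sq ht).symm
  rw [tendsto_zero_iff_norm_tendsto_zero]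
  have := hsq.sqrt
  simpa using this

end Solutions

/-! ### Finite escape under a destabilizing feedback. -/

/-- A state feedback `x ↦ u` with values in `[0, 1]` that destabilizes the planar subsystem. -/
def feedback (x : ℝ × ℝ) : ℝ := 1 / 2 + x.1 * x.2 / (1 + sqNorm x)

lemma feedback_mem_Icc (x : ℝ × ℝ) : feedback x ∈ Icc (0 : ℝ) 1 := by
  have h : 0 < 1 + sqNorm x := by linarith [sqNorm_nonneg x]
  have h1 : x.1 * x.2 / (1 + sqNorm x) ≤ 1 / 2 := by
    rw [div_le_iff₀ h]; unfold sqNorm; nlinarith [sq_nonneg (x.1 - x.2)]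
  have h2 : -(1 / 2) ≤ x.1 * x.2 / (1 + sqNorm x) := by
    rw [le_div_iff₀ h]; unfold sqNorm; nlinarith [sq_nonneg (x.1 + x.2)]
  unfold feedback
  constructor <;> linarith

lemma contDiff_feedback : ContDiff ℝ 1 feedback := by
  unfold feedback
  have h : ContDiff ℝ 1 sqNorm := by unfold sqNorm; fun_prop
  exact contDiff_const.add ((contDiff_fst.mul contDiff_snd).div (contDiff_const.add h)
    fun x => by linarith [sqNorm_nonneg x])

/-- The planar subsystem with `w = 1` in closed loop with `feedback`. -/
def closedLoopField (c : ℝ) (x : ℝ × ℝ) : ℝ × ℝ := planarField c ((1, feedback x), x)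

lemma contDiff_closedLoopField (c : ℝ) : ContDiff ℝ 1 (closedLoopField c) :=
  (contDiff_planarField c).comp ((contDiff_const.prodMk contDiff_feedback).prodMk contDiff_id)

/-- The factor 1 + |x|² cancels the denominator of `feedback`, so the closed loop is polynomial. The
feedback is tuned to x · A(u)x, whose u-dependent indefinite part is 3(u - 1/2)x₁x₂. -/
lemma closedLoopField_fst (c : ℝ) (x : ℝ × ℝ) :
    (closedLoopField c x).1 = c * ((1 + sqNorm x) * (-(1 / 20) * x.1 + 5 / 4 * x.2) +
      x.1 * x.2 * (1 / 10 * x.1 + 3 / 2 * x.2)) := by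
  have h : 1 + sqNorm x ≠ 0 := by linarith [sqNorm_nonneg x]
  simp only [closedLoopField, planarField, mixedField, feedback, Prod.fst_add, Prod.smul_fst,
    smul_eq_mul]
  field_simp
  ring

lemma closedLoopField_snd (c : ℝ) (x : ℝ × ℝ) :
    (closedLoopField c x).2 = c * ((1 + sqNorm x) * (-(5 / 4) * x.1 - 1 / 20 * x.2) +
      x.1 * x.2 * (3 / 2 * x.1 - 1 / 10 * x.2)) := by
  have h : 1 + sqNorm x ≠ 0 := by linarith [sqNorm_nonneg x]
  simp only [closedLoopField, planarField, mixedField, feedback, Prod.snd_add, Prod.smul_snd,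
    smul_eq_mul]
  field_simp
  ring

/-- A quartic form that grows along the closed loop. -/
def growthForm (x : ℝ × ℝ) : ℝ := sqNorm x ^ 2 + (x.1 * x.2 ^ 3 - x.1 ^ 3 * x.2) / 2

/-- The derivative of `growthForm` at `x` in the direction `v`. -/
def growthFormDeriv (x v : ℝ × ℝ) : ℝ :=
  4 * sqNorm x * (x.1 * v.1 + x.2 * v.2) +
    (v.1 * (x.2 ^ 3 - 3 * x.1 ^ 2 * x.2) + v.2 * (3 * x.1 * x.2 ^ 2 - x.1 ^ 3)) / 2

lemma hasDerivWithinAt_growthForm {x : ℝ → ℝ × ℝ} {v : ℝ × ℝ} {s : Set ℝ} {t : ℝ}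
    (h : HasDerivWithinAt x v s t) :
    HasDerivWithinAt (fun t => growthForm (x t)) (growthFormDeriv (x t) v) s t := by
  have h1 := hasDerivWithinAt_fst h
  have h2 := hasDerivWithinAt_snd h
  refine (((hasDerivWithinAt_sqNorm h).pow 2).add
    (((h1.mul (h2.pow 3)).sub ((h1.pow 3).mul h2)).div_const 2)).congr_deriv ?_
  simp [growthFormDeriv]
  ring

/-- In polar coordinates the form is r⁴(1 - sin(4θ)/8). -/
lemma growthForm_le (x : ℝ × ℝ) : growthForm x ≤ 9 / 8 * sqNorm x ^ 2 := by
  unfold growthForm sqNorm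
  nlinarith [sq_nonneg (2 * (x.1 * x.2) + (x.1 ^ 2 - x.2 ^ 2))]

/-- Here 2x₁x₂ = r² sin 2θ and x₁² - x₂² = r² cos 2θ. The feedback produces growth away from the
axes only; the clockwise rotation acting on the sin 4θ correction supplies growth on the axes, at
the expense of the diagonals. -/
lemma growthFormDeriv_closedLoopField (c : ℝ) (x : ℝ × ℝ) :
    growthFormDeriv x (closedLoopField c x) =
      c * ((1 + sqNorm x) * (17 / 40 * (x.1 ^ 2 - x.2 ^ 2) ^ 2 - 33 / 40 * (2 * x.1 * x.2) ^ 2 +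
          1 / 20 * (2 * x.1 * x.2) * (x.1 ^ 2 - x.2 ^ 2)) +
        sqNorm x * (119 / 40 * (2 * x.1 * x.2) ^ 2 -
          7 / 40 * (2 * x.1 * x.2) * (x.1 ^ 2 - x.2 ^ 2))) := by
  rw [growthFormDeriv, closedLoopField_fst, closedLoopField_snd]
  unfold sqNorm
  ring

lemma le_growthFormDeriv {c : ℝ} (hc : 0 ≤ c) {x : ℝ × ℝ} (hx : 1 ≤ sqNorm x) :
    3 / 10 * c * sqNorm x ^ 3 ≤ growthFormDeriv x (closedLoopField c x) := by
  rw [growthFormDeriv_closedLoopField, mul_comm (3 / 10) c, mul_assoc]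
  refine mul_le_mul_of_nonneg_left ?_ hc
  have hS : sqNorm x ^ 2 = (2 * x.1 * x.2) ^ 2 + (x.1 ^ 2 - x.2 ^ 2) ^ 2 := by
    unfold sqNorm; ring
  have h3 : sqNorm x ^ 3 = sqNorm x * sqNorm x ^ 2 := by ring
  rw [h3, hS]
  generalize sqNorm x = ρ at hx
  generalize 2 * x.1 * x.2 = S
  generalize x.1 ^ 2 - x.2 ^ 2 = C
  have hρ : 0 ≤ ρ := by linarith
  have k1 : 0 ≤ 17 / 40 * C ^ 2 + 66 / 100 * S ^ 2 - 1 / 20 * S * C := by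
    nlinarith [sq_nonneg (S - C), sq_nonneg (S + C)]
  have k2 : 0 ≤ ρ * (1 / 8 * C ^ 2 + 1 * S ^ 2 - 1 / 8 * S * C) :=
    mul_nonneg hρ (by nlinarith [sq_nonneg (S - C), sq_nonneg (S + C)])
  have k3 : 0 ≤ (ρ - 1) * (33 / 40 * S ^ 2) := mul_nonneg (by linarith) (by positivity)
  have k4 : 0 ≤ (ρ - 1) * (17 / 40 * C ^ 2) := mul_nonneg (by linarith) (by positivity)
  have k5 : 0 ≤ 17 / 40 * C ^ 2 + 1 / 20 * S * C + S ^ 2 := by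
    nlinarith [sq_nonneg (S - C), sq_nonneg (S + C)]
  nlinarith [mul_nonneg hρ (sq_nonneg S)]

/-- A barrier argument: the form starts at 4, and on the level 4 one has |x| ≥ 1, so its derivative
is positive there. -/
lemma four_le_growthForm {c : ℝ} (hc : 0 < c) {τ : ℝ} {x : ℝ → ℝ × ℝ} (hx0 : x 0 = (1, 1))
    (hx : IsIntegralCurveOn x (fun _ z => closedLoopField c z) (Icc 0 τ)) {t : ℝ}
    (ht : t ∈ Icc 0 τ) : 4 ≤ growthForm (x t) := by
  have hW := fun s hs => hasDerivWithinAt_growthForm (hx s hs)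
  have h := image_le_of_deriv_right_lt_deriv_boundary (a := 0) (b := τ)
    (f := fun s => -growthForm (x s)) (f' := fun s => -growthFormDeriv (x s) (closedLoopField c (x s)))
    (B := fun _ => -4) (B' := fun _ => 0) (fun s hs => (hW s hs).continuousWithinAt.neg)
    (fun s hs => ((hW s (Ico_subset_Icc_self hs)).mono_of_mem_nhdsWithin
      (Icc_mem_nhdsGE_of_mem hs)).neg)
    (by simp [hx0, growthForm, sqNorm]; norm_num) (fun s => hasDerivAt_const s _) (fun s _ hs => ?_) ht
  · linarith
  · have h1 := growthForm_le (x s)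
    have h2 : 1 ≤ sqNorm (x s) := by
      by_contra! hlt
      nlinarith [sqNorm_nonneg (x s)]
    have h3 := le_growthFormDeriv hc.le h2
    have h4 : 0 < 3 / 10 * c * sqNorm (x s) ^ 3 := by positivity
    linarith

lemma one_le_sqNorm_of_growthForm {x : ℝ × ℝ} (h : 4 ≤ growthForm x) : 1 ≤ sqNorm x := by
  by_contra! hlt
  nlinarith [sqNorm_nonneg x, growthForm_le x]

/-- The closed loop has finite escape time. -/
lemma lt_of_isIntegralCurveOn_closedLoopField {c : ℝ} (hc : 0 < c) {τ : ℝ} (hτ : 0 ≤ τ)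
    {x : ℝ → ℝ × ℝ} (hx0 : x 0 = (1, 1))
    (hx : IsIntegralCurveOn x (fun _ z => closedLoopField c z) (Icc 0 τ)) : c * τ < 5 := by
  have hpos : ∀ t ∈ Icc 0 τ, 4 ≤ growthForm (x t) := fun t ht => four_le_growthForm hc hx0 hx ht
  -- With W the form, W' ≥ (3/10)c|x|⁶ and √W ≤ (11/10)|x|² give (W^(-1/2))' ≤ -c/10. As W^(-1/2)
  -- starts at 1/2 and stays positive, cτ < 5.
  have hd : ∀ t ∈ Icc 0 τ, HasDerivWithinAt
      (fun t => (Real.sqrt (growthForm (x t)))⁻¹ + c / 10 * t)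
      (-(growthFormDeriv (x t) (closedLoopField c (x t)) / (2 * Real.sqrt (growthForm (x t)))) /
        Real.sqrt (growthForm (x t)) ^ 2 + c / 10) (Icc 0 τ) t := by
    intro t ht
    have h4 := hpos t ht
    refine (((hasDerivWithinAt_growthForm (hx t ht)).sqrt (by linarith)).inv
      (Real.sqrt_pos.2 (by linarith)).ne').add ?_
    simpa using ((hasDerivAt_id t).const_mul (c / 10)).hasDerivWithinAt
  have hanti := antitoneOn_of_hasDerivWithinAt_nonpos (convex_Icc 0 τ)
    (fun t ht => (hd t ht).continuousWithinAt)
    (fun t ht => (hd t (interior_subset ht)).mono interior_subset) (fun t ht => ?_)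
  · have h := hanti ⟨le_rfl, hτ⟩ ⟨hτ, le_rfl⟩ hτ
    have h2 : Real.sqrt (growthForm (x 0)) = 2 := by
      rw [show growthForm (x 0) = 2 ^ 2 by simp [hx0, growthForm, sqNorm]; norm_num]
      exact Real.sqrt_sq (by norm_num)
    have h3 : 0 < (Real.sqrt (growthForm (x τ)))⁻¹ :=
      inv_pos.2 (Real.sqrt_pos.2 (by linarith [hpos τ ⟨hτ, le_rfl⟩]))
    simp only [h2] at h
    norm_num at h
    linarith
  · have h4 := hpos t (interior_subset ht)
    have hρ := one_le_sqNorm_of_growthForm h4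
    have h5 := le_growthFormDeriv hc.le hρ
    have h6 := growthForm_le (x t)
    have hs : 0 < Real.sqrt (growthForm (x t)) := Real.sqrt_pos.2 (by linarith)
    have hss : Real.sqrt (growthForm (x t)) ^ 2 = growthForm (x t) := Real.sq_sqrt (by linarith)
    set s := Real.sqrt (growthForm (x t))
    set ρ := sqNorm (x t)
    have hsρ : s ≤ 11 / 10 * ρ := by
      by_contra! hlt
      nlinarith
    have hs3 : s ^ 3 ≤ (11 / 10 * ρ) ^ 3 := pow_le_pow_left₀ hs.le hsρ 3
    have key : c / 10 * (2 * s ^ 3) ≤ growthFormDeriv (x t) (closedLoopField c (x t)) := by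
      have h7 : 0 ≤ ρ ^ 3 := by positivity
      nlinarith [mul_le_mul_of_nonneg_left hs3 hc.le, mul_nonneg hc.le h7]
    have e : growthFormDeriv (x t) (closedLoopField c (x t)) / (2 * s) / s ^ 2 =
        growthFormDeriv (x t) (closedLoopField c (x t)) / (2 * s ^ 3) := by
      field_simp
    rw [neg_div, e]
    have := (le_div_iff₀ (by positivity : 0 < 2 * s ^ 3)).2 key
    linarith

lemma exists_closedLoop_norm_eq {R : ℝ} (hR : 1 < R) :
    ∃ τ ∈ Ioc (0 : ℝ) (1 / 4), ∃ x : ℝ → ℝ × ℝ, x 0 = (1, 1) ∧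
      IsIntegralCurveOn x (fun _ z => closedLoopField 100 z) (Icc 0 τ) ∧ ‖x τ‖ = R := by
  obtain ⟨τ, hτ, x, hx0, hx, h | h⟩ := exists_isIntegralCurveOn_or_norm_eq
    (P := ℝ) (G := fun q => closedLoopField 100 q.2)
    ((contDiff_closedLoopField 100).comp contDiff_snd) (p := fun _ => 0) continuous_const
    (T := 1 / 4) (by norm_num) (R := R) (x₀ := (1, 1)) (by simpa [Prod.norm_def] using hR)
  · exact ⟨τ, hτ, x, hx0, hx, h⟩
  · have := lt_of_isIntegralCurveOn_closedLoopField (by norm_num) hτ.1.le hx0 hx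
    rw [h] at this
    norm_num at this

/-! ### Lower bounds on the decay of the planar subsystem. -/

lemma neg_sqNorm_le_inner_mixedField {u : ℝ} (hu : u ∈ Icc (0 : ℝ) 1) (x : ℝ × ℝ) :
    -sqNorm x ≤ x.1 * (mixedField u x).1 + x.2 * (mixedField u x).2 := by
  obtain ⟨h0, h1⟩ := hu
  unfold sqNorm mixedField
  nlinarith [mul_nonneg h0 (sq_nonneg (x.1 + x.2)), mul_nonneg (sub_nonneg.2 h1) (sq_nonneg (x.1 - x.2)),
    mul_nonneg h0 (sq_nonneg x.2), mul_nonneg (sub_nonneg.2 h1) (sq_nonneg x.1),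
    mul_nonneg h0 (sq_nonneg x.1), mul_nonneg (sub_nonneg.2 h1) (sq_nonneg x.2)]

lemma inner_planarField (c : ℝ) (p x : ℝ × ℝ) :
    x.1 * (planarField c (p, x)).1 + x.2 * (planarField c (p, x)).2 =
      c * (p.1 * (1 + sqNorm x) * (x.1 * (mixedField p.2 x).1 + x.2 * (mixedField p.2 x).2) +
        (1 - p.1) * (x.1 * (mixedField 0 x).1 + x.2 * (mixedField 0 x).2)) := by
  simp only [planarField, Prod.fst_add, Prod.snd_add, Prod.smul_fst, Prod.smul_snd, smul_eq_mul]
  ring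

lemma le_inner_planarField {c : ℝ} (hc : 0 ≤ c) {p : ℝ × ℝ}
    (hp : p ∈ Icc (0 : ℝ) 1 ×ˢ Icc (0 : ℝ) 1) (x : ℝ × ℝ) :
    -c * (1 + p.1 * sqNorm x) * sqNorm x ≤
      x.1 * (planarField c (p, x)).1 + x.2 * (planarField c (p, x)).2 := by
  have h1 := mul_le_mul_of_nonneg_left (neg_sqNorm_le_inner_mixedField hp.2 x)
    (mul_nonneg hp.1.1 (by linarith [sqNorm_nonneg x] : 0 ≤ 1 + sqNorm x))
  have h2 := mul_le_mul_of_nonneg_left (neg_sqNorm_le_inner_mixedField (u := 0) (by simp) x)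
    (sub_nonneg.2 hp.1.2)
  rw [inner_planarField]
  have := mul_le_mul_of_nonneg_left (add_le_add h1 h2) hc
  linarith

section LowerBounds

variable {c : ℝ} {p : ℝ → ℝ × ℝ} {a b : ℝ} {x : ℝ → ℝ × ℝ}

/-- Over a short time, the squared norm decreases by a factor of at most two. -/
lemma le_two_mul_sqNorm (hc : 0 < c)
    (hp : ∀ t, p t ∈ Icc (0 : ℝ) 1 ×ˢ Icc (0 : ℝ) 1)
    (hx : IsIntegralCurveOn x (fun t z => planarField c (p t, z)) (Icc a b)) {t : ℝ}
    (ht : t ∈ Icc a b) (hshort : 2 * c * (t - a) * (2 + sqNorm (x a)) ≤ 1) :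
    sqNorm (x a) ≤ 2 * sqNorm (x t) := by
  have hpos : ∀ s, 0 < 1 + sqNorm (x s) := fun s => by linarith [sqNorm_nonneg (x s)]
  -- For ρ = |x|² one has ρ' ≥ -2cρ(1 + ρ), so q = ρ/(1 + ρ) obeys the linear inequality q' ≥ -2cq.
  -- Over the allowed time q stays above Y/(2 + Y), with Y the initial ρ, which says exactly ρ ≥
  -- Y/2.
  have hd : ∀ s ∈ Icc a b, HasDerivWithinAt (fun s => sqNorm (x s) / (1 + sqNorm (x s)))
      (2 * ((x s).1 * (planarField c (p s, x s)).1 + (x s).2 * (planarField c (p s, x s)).2) /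
        (1 + sqNorm (x s)) ^ 2) (Icc a b) s := by
    intro s hs
    have h := hasDerivWithinAt_sqNorm (hx s hs)
    refine (h.div (h.const_add 1) (hpos s).ne').congr_deriv ?_
    ring
  have h := mul_exp_le_of_le_deriv (C := -(2 * c)) hd (fun s hs => ?_) ht
  · have h1 : 1 - 2 * c * (t - a) ≤ Real.exp (-(2 * c) * (t - a)) := by
      have := Real.add_one_le_exp (-(2 * c) * (t - a))
      linarith
    have hY := sqNorm_nonneg (x a)
    have hy := sqNorm_nonneg (x t)
    have hYp := hpos a
    have hyp := hpos t
    have h2 : sqNorm (x a) / (2 + sqNorm (x a)) ≤ sqNorm (x t) / (1 + sqNorm (x t)) := by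
      refine le_trans ?_ h
      have h3 : (1 + sqNorm (x a)) / (2 + sqNorm (x a)) ≤ Real.exp (-(2 * c) * (t - a)) := by
        refine le_trans ?_ h1
        rw [div_le_iff₀ (by linarith)]
        linarith
      refine le_trans (le_of_eq ?_) (mul_le_mul_of_nonneg_left h3 (by positivity))
      have : 2 + sqNorm (x a) ≠ 0 := by linarith
      field_simp
    rw [div_le_div_iff₀ (by linarith) hyp] at h2
    nlinarith
  · have h1 := le_inner_planarField hc.le (hp s) (x s)
    have hy := sqNorm_nonneg (x s)
    have h2 : -c * (1 + sqNorm (x s)) * sqNorm (x s) ≤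
        -c * (1 + (p s).1 * sqNorm (x s)) * sqNorm (x s) := by
      have := mul_le_mul_of_nonneg_right (hp s).1.2 hy
      nlinarith [mul_nonneg hc.le hy, mul_nonneg (mul_nonneg hc.le hy) (sub_nonneg.2 this)]
    rw [le_div_iff₀ (by have := hpos s; positivity)]
    have e : -(2 * c) * (sqNorm (x s) / (1 + sqNorm (x s))) * (1 + sqNorm (x s)) ^ 2 =
        2 * (-c * (1 + sqNorm (x s)) * sqNorm (x s)) := by
      have := (hpos s).ne'
      field_simp
    rw [e]
    linarith

lemma sqNorm_mul_exp_le (hc : 0 < c) (hp : ∀ t, p t ∈ Icc (0 : ℝ) 1 ×ˢ Icc (0 : ℝ) 1)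
    (hx : IsIntegralCurveOn x (fun t z => planarField c (p t, z)) (Icc a b))
    (hw : ∀ t ∈ Icc a b, (p t).1 = 0) {t : ℝ} (ht : t ∈ Icc a b) :
    sqNorm (x a) * Real.exp (-(2 * c) * (t - a)) ≤ sqNorm (x t) := by
  refine mul_exp_le_of_le_deriv (fun s hs => hasDerivWithinAt_sqNorm (hx s hs)) (fun s hs => ?_) ht
  have h1 := le_inner_planarField hc.le (hp s) (x s)
  rw [hw s hs] at h1
  linarith

end LowerBounds

/-! ### Histories of norm at most 2 with large, long-lived solutions. -/

/-- A history whose delayed inputs follow the feedback along `x` up to time `τ` and then switch off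
within time `η`. -/
def switchingState {τ : ℝ} (hτ : 0 ≤ τ) (η : ℝ) {x : ℝ → ℝ × ℝ}
    (hx : ContinuousOn x (Icc 0 τ)) : State 2 4 where
  toFun s := !₂[1, 1, feedback (x (projIcc 0 τ hτ (s + 1))), sat (1 - (s + 2 - τ) / η)]
  continuous_toFun := by
    have hxc : Continuous fun s : Icc (-2 : ℝ) 0 => x (projIcc 0 τ hτ (s + 1)) :=
      hx.comp_continuous (continuous_subtype_val.comp (continuous_projIcc.comp (by fun_prop)))
        fun s => Subtype.coe_prop _
    refine (PiLp.continuous_toLp 2 _).comp (continuous_pi fun i => ?_)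
    fin_cases i
    · exact continuous_const
    · exact continuous_const
    · exact contDiff_feedback.continuous.comp hxc
    · exact continuous_sat.comp (by fun_prop)

section SwitchingState

variable {τ : ℝ} {hτ : 0 ≤ τ} {η : ℝ} {x : ℝ → ℝ × ℝ} {hx : ContinuousOn x (Icc 0 τ)}

lemma switchingState_apply (s : Icc (-2 : ℝ) 0) : switchingState hτ η hx s =
    !₂[1, 1, feedback (x (projIcc 0 τ hτ (s + 1))), sat (1 - (s + 2 - τ) / η)] := rfl

lemma norm_switchingState_le : ‖switchingState hτ η hx‖ ≤ 2 := by
  refine (ContinuousMap.norm_le _ zero_le_two).2 fun s => ?_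
  refine (sq_le_sq₀ (norm_nonneg _) zero_le_two).1 ?_
  rw [switchingState_apply, norm_sq_eq]
  have h1 := feedback_mem_Icc (x (projIcc 0 τ hτ (s + 1)))
  have h2 := sat_mem_Icc (1 - (s + 2 - τ) / η)
  simp [sqNorm]
  nlinarith [h1.1, h1.2, h2.1, h2.2]

lemma delayedInput_switchingState (hη : 0 < η) (hτ1 : τ ≤ 1) {t : ℝ} (ht : t ∈ Icc 0 τ) :
    delayedInput (switchingState hτ η hx) t = (1, feedback (x t)) := by
  have e1 : decayPath (switchingState hτ η hx) 3 (t - 2) = 1 := by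
    rw [decayPath_of_nonpos _ _ (by linarith [ht.2]), pastPath,
      projIcc_of_mem _ ⟨by linarith [ht.1], by linarith [ht.2]⟩, switchingState_apply]
    have : (t - τ) / η ≤ 0 := div_nonpos_of_nonpos_of_nonneg (by linarith [ht.2]) hη.le
    simp only [sat_eq]
    simp
    rw [min_eq_left (by linarith), max_eq_right zero_le_one]
  have e2 : decayPath (switchingState hτ η hx) 2 (t - 1) = feedback (x t) := by
    rw [decayPath_of_nonpos _ _ (by linarith [ht.2]), pastPath,
      projIcc_of_mem _ ⟨by linarith [ht.1], by linarith [ht.2]⟩, switchingState_apply]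
    simp [projIcc_of_mem hτ ht]
  rw [delayedInput, e1, e2, sat_of_mem_Icc (feedback_mem_Icc _), sat_of_mem_Icc (by simp)]

lemma delayedInput_switchingState_fst (hη : 0 < η) (hτη : τ + η ≤ 2) {t : ℝ} (ht : τ + η ≤ t) :
    (delayedInput (switchingState hτ η hx) t).1 = 0 := by
  have key : ∀ s : Icc (-2 : ℝ) 0, τ + η ≤ s + 2 → switchingState hτ η hx s 3 = 0 := by
    intro s hs
    rw [switchingState_apply]
    have : 1 ≤ ((s : ℝ) + 2 - τ) / η := by rw [le_div_iff₀ hη]; linarith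
    simp only [sat_eq]
    simp
    exact Or.inr this
  have : decayPath (switchingState hτ η hx) 3 (t - 2) = 0 := by
    rw [decayPath, pastPath, key, zero_mul]
    rw [coe_projIcc]
    have : τ + η - 2 ≤ max (-2) (min 0 (t - 2)) :=
      le_max_of_le_right (le_min (by linarith) (by linarith))
    linarith
  rw [delayedInput, this, sat_of_mem_Icc (by simp)]

end SwitchingState

/-- Solutions that start in the ball of radius `2` become arbitrarily large within one time unit
and stay outside the unit ball for an arbitrarily long time. -/
theorem exists_large_solution {T : ℝ} (hT : 0 < T) (R : ℝ) :
    ∃ X₀ : State 2 4, ‖X₀‖ ≤ 2 ∧ ∃ X : ℝ → EuclideanSpace ℝ (Fin 4),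
      IsGlobalSolution (rhs 100) X₀ X ∧ (∀ t ∈ Icc 0 T, 1 ≤ ‖X t‖) ∧
        ∃ t ∈ Icc (0 : ℝ) 1, R ≤ ‖X t‖ := by
  have hE : 1 ≤ Real.exp (200 * T) := Real.one_le_exp (by positivity)
  -- The 2 pays for the switching phase and exp(2cT), c = 100, for the linear decay afterwards.
  set R' := |R| + 2 * Real.exp (200 * T)
  have hR' : 1 < R' := by have := abs_nonneg R; simp only [R']; linarith
  obtain ⟨τ, hτ, x, hx0, hx, hxτ⟩ := exists_closedLoop_norm_eq hR'
  set Y := sqNorm (x τ) with hYdef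
  have hY : R' ^ 2 ≤ Y := hxτ ▸ norm_sq_le_sqNorm (x τ)
  have hY0 : 0 ≤ Y := sqNorm_nonneg _
  -- The longest time that `le_two_mul_sqNorm` allows from the value `Y`.
  set η := 1 / (200 * (2 + Y)) with hηdef
  have hη : 0 < η := by positivity
  have hη1 : η ≤ 1 := by
    rw [hηdef, div_le_one (by positivity)]; linarith
  set X₀ := switchingState hτ.1.le η hx.continuousOn
  obtain ⟨X, hX⟩ := forwardComplete_rhs (c := 100) (by norm_num) X₀
  set y : ℝ → ℝ × ℝ := fun t => (X t 0, X t 1) with hydef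
  have hy : ∀ b, IsIntegralCurveOn y (fun t z => planarField 100 (delayedInput X₀ t, z))
      (Icc 0 b) := fun b => hX.1.isIntegralCurveOn (EReal.coe_lt_top b)
  have hle : ∀ t, sqNorm (y t) ≤ ‖X t‖ ^ 2 := fun t => by
    rw [norm_sq_eq]; nlinarith [sq_nonneg (X t 2), sq_nonneg (X t 3)]
  have hone : ∀ t, 1 ≤ sqNorm (y t) → 1 ≤ ‖X t‖ := fun t ht => by
    by_contra! h
    nlinarith [hle t, norm_nonneg (X t)]
  have hyx : EqOn y x (Icc 0 τ) := by
    refine eqOn_of_isIntegralCurveOn (contDiff_planarField 100) (continuous_delayedInput X₀)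
      (hy τ) (fun t ht => ?_) ?_
    · have e := delayedInput_switchingState (hτ := hτ.1.le) (hx := hx.continuousOn) hη (by linarith [hτ.2]) ht
      exact (hx t ht).congr_deriv (congrArg (fun q => planarField 100 (q, x t)) e.symm)
    · rw [hx0, hydef]
      simp only
      rw [hX.1.eq_pastPath ⟨by norm_num, le_rfl⟩, pastPath, switchingState_apply]
      simp
  have hyτ : y τ = x τ := hyx ⟨hτ.1.le, le_rfl⟩
  have hhalf : ∀ t ∈ Icc τ (τ + η), Y ≤ 2 * sqNorm (y t) := by
    intro t ht
    have h := le_two_mul_sqNorm (by norm_num) (delayedInput_mem X₀)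
      ((hy (τ + η)).mono (Icc_subset_Icc_left hτ.1.le)) ht ?_
    · rwa [hyτ] at h
    · rw [hyτ, ← hYdef]
      have h1 : η * (200 * (2 + Y)) = 1 := by rw [hηdef]; field_simp
      nlinarith [ht.2]
  have hYR : R' ≤ Y := by nlinarith
  have hYE : 2 * Real.exp (200 * T) ≤ Y := by
    have := abs_nonneg R; simp only [R'] at hYR; linarith
  refine ⟨X₀, norm_switchingState_le, X, hX, fun t ht => hone t ?_, τ,
    ⟨hτ.1.le, by linarith [hτ.2]⟩, ?_⟩
  · rcases le_total t τ with h1 | h1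
    · rw [hyx ⟨ht.1, h1⟩]
      exact one_le_sqNorm_of_growthForm (four_le_growthForm (by norm_num) hx0 hx ⟨ht.1, h1⟩)
    rcases le_total t (τ + η) with h2 | h2
    · linarith [hhalf t ⟨h1, h2⟩]
    · have h3 := hhalf (τ + η) ⟨by linarith, le_rfl⟩
      have h4 := sqNorm_mul_exp_le (by norm_num) (delayedInput_mem X₀)
        ((hy t).mono (Icc_subset_Icc_left (by linarith [hτ.1] : 0 ≤ τ + η)))
        (fun s hs => delayedInput_switchingState_fst hη (by linarith [hτ.2]) hs.1) ⟨h2, le_rfl⟩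
      refine le_trans ?_ h4
      have h5 : Real.exp (-(200 * T)) ≤ Real.exp (-(2 * 100) * (t - (τ + η))) :=
        Real.exp_le_exp.2 (by linarith [ht.2, hτ.1])
      calc (1 : ℝ) = Real.exp (200 * T) * Real.exp (-(200 * T)) := by rw [← Real.exp_add]; simp
        _ ≤ _ := mul_le_mul (by linarith) h5 (Real.exp_pos _).le (sqNorm_nonneg _)
  · have h := hle τ
    rw [hyτ] at h
    have h1 : R' ≤ ‖X τ‖ := (sq_le_sq₀ (by linarith) (norm_nonneg _)).1 (hY.trans h)
    have := le_abs_self R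
    simp only [R'] at h1
    linarith

end TimeDelay

end

theorem proposition1 :
    (∀ c : ℝ, 0 < c →
      TimeDelay.ForwardComplete (TimeDelay.rhs c) ∧
      TimeDelay.LocallyExponentiallyStable (TimeDelay.rhs c) ∧
      TimeDelay.GloballyAsymptoticallyStable (TimeDelay.rhs c)) ∧
    (∃ c : ℝ, 0 < c ∧
      ¬ TimeDelay.BoundedReachabilitySets (TimeDelay.rhs c) ∧
      (¬ TimeDelay.UniformlyGloballyAttractive (TimeDelay.rhs c) ∧
        ∀ T : ℝ, 0 < T → ∃ X₀ : TimeDelay.State 2 4, ‖X₀‖ ≤ 2 ∧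
          ∃ X : ℝ → EuclideanSpace ℝ (Fin 4),
            TimeDelay.IsGlobalSolution (TimeDelay.rhs c) X₀ X ∧ 1 ≤ ‖X T‖) ∧
      ¬ TimeDelay.WeaklyUniformlyGloballyAttractive (TimeDelay.rhs c)) := by
  refine ⟨fun c hc => ⟨TimeDelay.forwardComplete_rhs hc,
    TimeDelay.locallyExponentiallyStable_rhs hc,
    (TimeDelay.locallyExponentiallyStable_rhs hc).lyapunovStable,
    TimeDelay.globallyAttractive_rhs hc⟩, 100, by norm_num, fun h => ?_, ⟨fun h => ?_, ?_⟩,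
    fun h => ?_⟩
  · obtain ⟨R, -, hR⟩ := h.2 2 (by norm_num) 1 (by norm_num)
    obtain ⟨X₀, hX₀, X, hX, -, t, ht, hRt⟩ := TimeDelay.exists_large_solution one_pos (R + 1)
    linarith [hR X₀ hX₀ X hX t ht]
  · obtain ⟨T, hT, hT'⟩ := h (1 / 2) (by norm_num) 2 (by norm_num)
    -- `T` may be 0, while the horizon must be positive.
    obtain ⟨X₀, hX₀, X, hX, h1, -⟩ :=
      TimeDelay.exists_large_solution (by linarith : 0 < T + 1) 0
    linarith [hT' X₀ hX₀ X hX T le_rfl, h1 T ⟨hT, by linarith⟩]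
  · intro T hT
    obtain ⟨X₀, hX₀, X, hX, h1, -⟩ := TimeDelay.exists_large_solution hT 0
    exact ⟨X₀, hX₀, X, hX, h1 T ⟨hT.le, le_rfl⟩⟩
  · obtain ⟨T, hT, hT'⟩ := h (1 / 2) (by norm_num) 2 (by norm_num)
    obtain ⟨X₀, hX₀, X, hX, h1, -⟩ :=
      TimeDelay.exists_large_solution (by linarith : 0 < T + 1) 0
    obtain ⟨t, ht, hXt⟩ := hT' X₀ hX₀ X hX
    linarith [h1 t ⟨ht.1, by linarith [ht.2]⟩]
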